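/- For a Gaussian prime $\pi$ of odd norm $N(\pi)$ and $\alpha\in\mathbb Z[i]$ let $\left(\frac{\alpha}{\pi}\right)_4$ be $0$ if $\pi\mid\alpha$, and otherwise the unique element of $\{1,i,-1,-i\}$ congruent to $\alpha^{(N(\pi)-1)/4}$ modulo $\pi$. For $\beta\in\mathbb Z[i]$ of odd norm, the quartic Jacobi symbol $\left(\frac{\alpha}{\beta}\right)_4$ is the product of the symbols $\left(\frac{\alpha}{\pi}\right)_4$ over the prime factors $\pi$ of $\beta$, counted with multiplicity. For an odd integer $m$ and a rational number $r$ whose denominator is prime to $m$, put $\left(\frac{r+i}{m}\right)_4=\left(\frac{n+i}{m}\right)_4$, where $n$ is any integer with $n\equiv r\pmod m$. **Theorem 3.2.** Let $p\equiv 1\pmod 4$ be a prime and let $q\in\mathbb Z$ satisfy $q\equiv 3\pmod 8$ and $p\nmid q$. Suppose that $p=c^2+d^2$ and $4p=x^2+qy^2$ with $c,d,x,y\in\mathbb Z$, $c\equiv y\equiv 1\pmod 4$ and $\gcd(d,x+2c)=1$, and let $k\in\mathbb Z$ satisfy $$\left(\frac{-2d/(x+2c)+i}{q}\right)_4=i^k.$$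 (Under these assumptions $x$ is odd, $p\nmid cx$, and $x+2c$ is nonzero and prime to $q$.) Then $$(-q)^{[p/8]}\equiv\begin{cases}(-1)^{[x/4]}\left(\dfrac dc\right)^k\pmod p&\text{if }8\mid p-1,\\[2mm]-(-1)^{(x^2-1)/8}\left(\dfrac dc\right)^k\dfrac yx\pmod p&\text{if }8\mid p-5,\end{cases}$$ where $[\cdot]$ is the greatest integer function and fractions are read modulo $p$. -/

import Mathlib

/-- The quartic residue symbol `(α/π)₄` for a Gaussian prime `π` of odd norm `N(π)`: it is `0` if
`π ∣ α`, and otherwise the unique `u ∈ {1, i, -1, -i}` with `α ^ ((N(π) - 1) / 4) ≡ u (mod π)`.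
(When `π ∤ α` has odd norm, one of the first three congruences below holds or else `u = -i`.) -/
noncomputable def quarticResidueSymbol (α π : GaussianInt) : GaussianInt :=
  open Classical in
  if π ∣ α then 0
  else if π ∣ α ^ (((Zsqrtd.norm π).natAbs - 1) / 4) - 1 then 1
  else if π ∣ α ^ (((Zsqrtd.norm π).natAbs - 1) / 4) - ⟨0, 1⟩ then ⟨0, 1⟩
  else if π ∣ α ^ (((Zsqrtd.norm π).natAbs - 1) / 4) + 1 then -1
  else -⟨0, 1⟩

/-- The quartic Jacobi symbol `(α/β)₄` for a Gaussian integer `β` of odd norm: the product of the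
symbols `(α/π)₄` over the prime factors `π` of `β`, with multiplicity; it is `1` if `β` is a unit.
The choice of the prime factors up to units does not matter. -/
noncomputable def quarticJacobiSymbol (α β : GaussianInt) : GaussianInt :=
  ((UniqueFactorizationMonoid.factors β).map (quarticResidueSymbol α)).prod

/-- An integer congruent to the rational number `r` modulo `m`, whenever the denominator of `r` is
prime to `m`: the numerator times a Bézout inverse of the denominator. -/
def ratResidue (r : ℚ) (m : ℤ) : ℤ :=
  r.num * Int.gcdA r.den m

theorem ratResidue_spec (r : ℚ) (m : ℤ) (h : Int.gcd r.den m = 1) :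
    r.den * ratResidue r m ≡ r.num [ZMOD m] := by
  have h1 := Int.gcd_eq_gcd_ab r.den m
  rw [h] at h1
  refine (Int.modEq_iff_dvd.2 ⟨r.num * Int.gcdB r.den m, ?_⟩)
  unfold ratResidue
  push_cast at h1
  linear_combination r.num * h1

/-- The quartic Jacobi symbol `((r + i)/m)₄` for an odd integer `m` and a rational number `r` with
denominator prime to `m`; here `r` is read modulo `m`. -/
noncomputable def quarticJacobiSymbolRat (r : ℚ) (m : ℤ) : GaussianInt :=
  quarticJacobiSymbol ⟨ratResidue r m, 1⟩ ⟨m, 0⟩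

/-! Let π = c + di, a Gaussian prime of norm p; reduction modulo π identifies i with d/c in `ZMod
p`. From 4p = x² + qy² one gets -q = (x/y)² modulo p, so a power of -q becomes (x/y)^((p-1)/4), the
image of (x/π)₄ (y/π)₄⁻¹. It remains to compare (x/π)₄ and (y/π)₄ with the symbol modulo q that
defines k.

The comparison (`quarticJacobiSymbol_representation`) goes through b = x + 2π = a + 2di with a = x +
2c. Its norm is 2xa + qy², hence qy² ≡ -2xa modulo b and (q/b)(y/b)² = (2/b)(x/b)(a/b). Reciprocity
turns each factor around: modulo x, b is 2π; modulo a, it is 2di; modulo y, b² is 4aπ; and ib = -2d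
+ ai is the numerator occurring modulo q. Symbols of coprime rational integers are 1, so only (π/x),
(y/π), the symbol modulo q, and the signs (2/b), (i/a), (i/q) survive.

The reciprocity needed is that between a rational integer n ≡ 1 modulo 4 and a Gaussian integer with
even imaginary part (`quarticJacobiSymbol_comm`). For primes it comes from the quartic Gauss sum g
modulo π, taken in an algebraically closed field of characteristic r ∣ n: there g⁴ = π²p, while
Frobenius expresses g^r through the character value at r. Comparing the two gives the law;
multiplicativity extends it. The value of (2/b) is deduced from reciprocity itself
(`quarticJacobiSymbol_two`). -/

namespace GaussianInt

/-! ### Gaussian integers of odd norm and the possible symbol values -/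

/-- The imaginary unit of the Gaussian integers. -/
abbrev imUnit : GaussianInt := ⟨0, 1⟩

theorem imUnit_sq : imUnit ^ 2 = -1 := by decide

theorem norm_eq (a : GaussianInt) : a.norm = a.re ^ 2 + a.im ^ 2 := by
  rw [Zsqrtd.norm_def]; ring

/-- The equation u⁵ = u packages "zero or a fourth root of unity" in a form stable under products
and conjugation. -/
theorem eq_zero_or_of_pow_five_eq {u : GaussianInt} (h : u ^ 5 = u) :
    u = 0 ∨ u = 1 ∨ u = -1 ∨ u = imUnit ∨ u = -imUnit := by
  have h1 : u * ((u - 1) * ((u + 1) * ((u - imUnit) * (u + imUnit)))) = 0 := by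
    linear_combination h + (u - u ^ 3) * imUnit_sq
  simp only [mul_eq_zero, sub_eq_zero, add_eq_zero_iff_eq_neg] at h1
  exact h1

theorem norm_sub_dvd_four {u v : GaussianInt} (hu : u ^ 5 = u) (hv : v ^ 5 = v) (h : u ≠ v) :
    (u - v).norm ∣ 4 := by
  rcases eq_zero_or_of_pow_five_eq hu with rfl | rfl | rfl | rfl | rfl <;>
  rcases eq_zero_or_of_pow_five_eq hv with rfl | rfl | rfl | rfl | rfl <;>
  first
    | exact absurd rfl h
    | decide

theorem odd_norm_mul {a b : GaussianInt} (ha : Odd a.norm) (hb : Odd b.norm) :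
    Odd (a * b).norm := by
  rw [Zsqrtd.norm_mul]; exact ha.mul hb

theorem ne_zero_of_odd_norm {a : GaussianInt} (ha : Odd a.norm) : a ≠ 0 := by
  rintro rfl; simp at ha

/-- Distinct elements of {0, ±1, ±i} differ by an element of norm 1, 2 or 4, which no nonunit of odd
norm divides. So a symbol value is determined by its residue class. -/
theorem eq_of_dvd_sub {π u v : GaussianInt} (hπ : ¬ IsUnit π) (hodd : Odd π.norm)
    (hu : u ^ 5 = u) (hv : v ^ 5 = v) (h : π ∣ u - v) : u = v := by
  by_contra hne
  have h1 : π.norm ∣ 4 := by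
    obtain ⟨c, hc⟩ := h
    refine dvd_trans ⟨c.norm, ?_⟩ (norm_sub_dvd_four hu hv hne)
    rw [hc, Zsqrtd.norm_mul]
  have h2 : IsCoprime π.norm ((2 : ℤ) ^ 2) :=
    (Int.isCoprime_two_right.2 hodd).pow_right
  have h3 : IsUnit π.norm := h2.isUnit_of_dvd' dvd_rfl (by simpa using h1)
  exact hπ ((Zsqrtd.isUnit_iff_norm_isUnit π).2 h3)

theorem norm_emod_four {a : GaussianInt} (ha : Odd a.norm) : a.norm % 4 = 1 := by
  rw [norm_eq] at *
  generalize a.re = x at *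
  generalize a.im = y at *
  obtain ⟨w, hw⟩ := ha
  obtain ⟨s, rfl | rfl⟩ := Int.even_or_odd' x <;> obtain ⟨t, rfl | rfl⟩ := Int.even_or_odd' y <;>
  ring_nf at * <;> omega

theorem parity {a : GaussianInt} (ha : Odd a.norm) :
    (Odd a.re ∧ Even a.im) ∨ (Even a.re ∧ Odd a.im) := by
  rw [norm_eq, Int.odd_add, Int.odd_pow' two_ne_zero, Int.even_pow' two_ne_zero] at ha
  rcases Int.even_or_odd a.re with h | h
  · right; exact ⟨h, by by_contra h2; simp [Int.not_odd_iff_even] at h2; exact (Int.not_odd_iff_even.2 h) (ha.2 h2)⟩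
  · exact Or.inl ⟨h, ha.1 h⟩

theorem isUnit_iff_eq {u : GaussianInt} (h : IsUnit u) :
    u = 1 ∨ u = -1 ∨ u = imUnit ∨ u = -imUnit := by
  have h1 : u.norm = 1 := (Zsqrtd.norm_eq_one_iff' (by norm_num) u).2 h
  rw [norm_eq] at h1
  obtain ⟨a, b⟩ := u
  simp only at h1
  have ha : a ≤ 1 := by nlinarith
  have ha' : -1 ≤ a := by nlinarith
  have hb : b ≤ 1 := by nlinarith
  have hb' : -1 ≤ b := by nlinarith
  interval_cases a <;> interval_cases b <;> first | (exfalso; omega) | decide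

theorem isUnit_of_pow_four {u : GaussianInt} (h : u ^ 4 = 1) : IsUnit u :=
  IsUnit.of_pow_eq_one h (by norm_num)

theorem mul_star_of_pow_four {u : GaussianInt} (h : u ^ 4 = 1) : u * star u = 1 := by
  rcases isUnit_iff_eq (isUnit_of_pow_four h) with rfl | rfl | rfl | rfl <;> decide

/-! ### Frobenius, classification of odd Gaussian primes, Fermat's theorem -/

/-- Frobenius on the Gaussian integers modulo an odd rational prime. -/
theorem dvd_pow_sub (p : ℕ) [hp : Fact p.Prime] (a : GaussianInt) (h2 : p % 4 ≠ 2) :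
    (p : GaussianInt) ∣ a ^ p - (if p % 4 = 1 then a else star a) := by
  -- Modulo p the power is additive, rational integers are fixed by Fermat, and i^p is i or -i
  -- according to p modulo 4.
  obtain ⟨r, hr⟩ := exists_add_pow_prime_eq hp.out (a.re : GaussianInt) (a.im * imUnit)
  have ha : (a.re : GaussianInt) + a.im * imUnit = a := by ext <;> simp
  have hint : ∀ n : ℤ, (p : GaussianInt) ∣ (n : GaussianInt) ^ p - n := fun n => by
    have : (p : ℤ) ∣ n ^ p - n := by
      rw [← ZMod.intCast_zmod_eq_zero_iff_dvd]; simp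
    have := (Zsqrtd.intCast_dvd_intCast (d := -1) (p : ℤ) (n ^ p - n)).2 this
    simpa using this
  rw [ha] at hr
  obtain ⟨s, hs⟩ := hint a.re
  obtain ⟨t, ht⟩ := hint a.im
  have hp2 : p % 4 = 1 ∨ p % 4 = 3 := by
    rcases hp.out.eq_two_or_odd with h | h <;> omega
  have hstar : star a = (a.re : GaussianInt) - a.im * imUnit := by ext <;> simp
  have h4 : imUnit ^ 4 = 1 := by decide
  rcases hp2 with h | h
  · have hi : imUnit ^ p = imUnit := by
      rw [← Nat.div_add_mod p 4, h, pow_add, pow_mul, h4]; simp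
    rw [if_pos h]
    rw [hr, mul_pow, hi]
    exact ⟨s + t * imUnit + a.re * (a.im * imUnit) * r,
      by linear_combination hs + imUnit * ht + ha⟩
  · have hi : imUnit ^ p = -imUnit := by
      rw [← Nat.div_add_mod p 4, h, pow_add, pow_mul, h4, one_pow]; decide
    rw [if_neg (by omega), hstar]
    rw [hr, mul_pow, hi]
    exact ⟨s - t * imUnit + a.re * (a.im * imUnit) * r, by linear_combination hs - imUnit * ht⟩

/-- Since π divides its norm, it divides some rational prime p, and then N(π) ∣ p². Norm p is the
split case, norm p² the inert one; odd norm rules out p = 2. -/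
theorem prime_cases {π : GaussianInt} (hπ : Prime π) (hodd : Odd π.norm) :
    ∃ p : ℕ, p.Prime ∧ π ∣ p ∧
      ((p % 4 = 1 ∧ π.norm = p) ∨ (p % 4 = 3 ∧ Associated π p)) := by
  have h0 : π ∣ (π.norm.natAbs : GaussianInt) := by
    rw [show ((π.norm.natAbs : ℕ) : GaussianInt) = ((π.norm.natAbs : ℤ) : GaussianInt) by simp,
      abs_natCast_norm, Zsqrtd.norm_eq_mul_conj]
    exact dvd_mul_right _ _
  obtain ⟨p, hp, hdvd⟩ : ∃ p : ℕ, p.Prime ∧ π ∣ p := by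
    have hne : π.norm.natAbs ≠ 0 := by
      rw [Int.natAbs_ne_zero, Ne, norm_eq_zero]; exact hπ.ne_zero
    rw [← Nat.prod_primeFactorsList hne, Nat.cast_list_prod, hπ.dvd_prod_iff] at h0
    obtain ⟨a, ha, hd⟩ := h0
    obtain ⟨p, hp, rfl⟩ := List.mem_map.1 ha
    exact ⟨p, Nat.prime_of_mem_primeFactorsList hp, hd⟩
  refine ⟨p, hp, hdvd, ?_⟩
  have := Fact.mk hp
  obtain ⟨c, hc⟩ := hdvd
  have hn : π.norm.natAbs * c.norm.natAbs = p ^ 2 := by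
    have := congrArg Zsqrtd.norm hc
    rw [Zsqrtd.norm_mul, Zsqrtd.norm_natCast] at this
    rw [← Int.natAbs_mul, ← this, sq, Int.natAbs_mul, Int.natAbs_natCast]
  have hmod := norm_emod_four hodd
  have habs := abs_natCast_norm π
  obtain ⟨k, hk, hk'⟩ := (Nat.dvd_prime_pow hp).1 (Dvd.intro _ hn)
  interval_cases k
  · exact absurd (Zsqrtd.norm_eq_one_iff.1 (by simpa using hk')) hπ.not_isUnit
  · left
    rw [pow_one] at hk'
    rw [hk'] at habs
    exact ⟨by omega, habs.symm⟩
  · right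
    have hc1 : c.norm.natAbs = 1 := by
      rw [hk'] at hn
      exact Nat.eq_of_mul_eq_mul_left (pow_pos hp.pos 2) (by rw [hn, mul_one])
    have hu := Zsqrtd.norm_eq_one_iff.1 hc1
    have has : Associated π p := ⟨hu.unit, by rw [hc]; rfl⟩
    exact ⟨mod_four_eq_three_of_nat_prime_of_prime p (has.prime hπ), has⟩

theorem dvd_pow_norm_sub {π : GaussianInt} (hπ : Prime π) (hodd : Odd π.norm) (a : GaussianInt) :
    π ∣ a ^ π.norm.natAbs - a := by
  obtain ⟨p, hp, hd, ⟨h4, hn⟩ | ⟨h4, has⟩⟩ := prime_cases hπ hodd <;> have := Fact.mk hp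
  · rw [hn, Int.natAbs_natCast]
    have := dvd_pow_sub p a (by omega)
    rw [if_pos h4] at this
    exact hd.trans this
  · have hn : π.norm.natAbs = p * p := by
      rw [Zsqrtd.norm_eq_of_associated (by norm_num) has, Zsqrtd.norm_natCast]
      rw [Int.natAbs_mul, Int.natAbs_natCast]
    have h1 := fun b => dvd_pow_sub p b (by omega)
    simp only [if_neg (show ¬ p % 4 = 1 by omega)] at h1
    refine hd.trans ?_
    rw [hn, pow_mul]
    -- In the inert case N(π) = p², and Frobenius applied twice is conjugation applied twice.
    have h2 := (h1 a).trans (sub_dvd_pow_sub_pow _ _ p)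
    simpa using dvd_add h2 (h1 (star a))

/-! ### The quartic residue symbol at a prime -/

/-- The exponent `(N(π) - 1) / 4`. -/
abbrev quarticExp (π : GaussianInt) : ℕ := (π.norm.natAbs - 1) / 4

theorem four_mul_quarticExp {π : GaussianInt} (hodd : Odd π.norm) :
    4 * quarticExp π + 1 = π.norm.natAbs := by
  have := norm_emod_four hodd
  have := abs_natCast_norm π
  unfold quarticExp
  omega

theorem quarticExp_pos {π : GaussianInt} (hπ : Prime π) (hodd : Odd π.norm) :
    0 < quarticExp π := by
  have h1 := four_mul_quarticExp hodd
  by_contra h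
  exact hπ.not_isUnit (Zsqrtd.norm_eq_one_iff.1 (by omega))

theorem dvd_pow_quarticExp_sub {π : GaussianInt} (hπ : Prime π) (hodd : Odd π.norm)
    (a : GaussianInt) :
    (quarticResidueSymbol a π) ^ 5 = quarticResidueSymbol a π ∧
      π ∣ a ^ quarticExp π - quarticResidueSymbol a π := by
  have hpos := quarticExp_pos hπ hodd
  unfold quarticResidueSymbol
  open Classical in
  change _ ∧ π ∣ a ^ quarticExp π - (if π ∣ a then (0 : GaussianInt)
    else if π ∣ a ^ quarticExp π - 1 then 1
    else if π ∣ a ^ quarticExp π - ⟨0, 1⟩ then ⟨0, 1⟩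
    else if π ∣ a ^ quarticExp π + 1 then -1 else -⟨0, 1⟩)
  split_ifs with h1 h2 h3 h4
  · exact ⟨by simp, by simpa using dvd_pow h1 hpos.ne'⟩
  · exact ⟨by decide, h2⟩
  · exact ⟨by decide, h3⟩
  · exact ⟨by decide, by simpa using h4⟩
  · refine ⟨by decide, ?_⟩
    have h5 := dvd_pow_norm_sub hπ hodd a
    rw [← four_mul_quarticExp hodd] at h5
    -- Fermat's expression splits as a times the four factors a^e - u with u⁴ = 1, where e = (N(π) -
    -- 1)/4. The earlier branches exclude all but u = -i.
    have h6 : a ^ (4 * quarticExp π + 1) - a = a * ((a ^ quarticExp π - 1) *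
        ((a ^ quarticExp π - imUnit) * ((a ^ quarticExp π + 1) *
          (a ^ quarticExp π - -imUnit)))) := by
      have : a ^ (4 * quarticExp π + 1) = (a ^ quarticExp π) ^ 4 * a := by
        rw [pow_succ, mul_comm 4, pow_mul]
      rw [this]
      linear_combination (a * ((a ^ quarticExp π) ^ 2 - 1)) * imUnit_sq
    rw [h6] at h5
    rcases hπ.dvd_or_dvd h5 with h | h
    · exact absurd h h1
    rcases hπ.dvd_or_dvd h with h | h
    · exact absurd h h2
    rcases hπ.dvd_or_dvd h with h | h
    · exact absurd h h3
    rcases hπ.dvd_or_dvd h with h | h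
    · exact absurd h h4
    · exact h

theorem quarticResidueSymbol_eq {π : GaussianInt} (hπ : Prime π) (hodd : Odd π.norm)
    {a u : GaussianInt} (hu : u ^ 5 = u) (h : π ∣ a ^ quarticExp π - u) :
    quarticResidueSymbol a π = u := by
  obtain ⟨h1, h2⟩ := dvd_pow_quarticExp_sub hπ hodd a
  refine eq_of_dvd_sub hπ.not_isUnit hodd h1 hu ?_
  simpa using dvd_sub h h2

theorem quarticResidueSymbol_mul {π : GaussianInt} (hπ : Prime π) (hodd : Odd π.norm)
    (a b : GaussianInt) : quarticResidueSymbol (a * b) π =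
      quarticResidueSymbol a π * quarticResidueSymbol b π := by
  obtain ⟨h1, h2⟩ := dvd_pow_quarticExp_sub hπ hodd a
  obtain ⟨h3, h4⟩ := dvd_pow_quarticExp_sub hπ hodd b
  refine quarticResidueSymbol_eq hπ hodd (by rw [mul_pow, h1, h3]) ?_
  obtain ⟨s, hs⟩ := h2
  obtain ⟨t, ht⟩ := h4
  rw [mul_pow]
  exact ⟨s * b ^ quarticExp π + quarticResidueSymbol a π * t,
    by linear_combination b ^ quarticExp π * hs + quarticResidueSymbol a π * ht⟩

theorem quarticResidueSymbol_congr {π : GaussianInt} (hπ : Prime π) (hodd : Odd π.norm)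
    {a b : GaussianInt} (h : π ∣ a - b) :
    quarticResidueSymbol a π = quarticResidueSymbol b π := by
  obtain ⟨h3, h4⟩ := dvd_pow_quarticExp_sub hπ hodd b
  refine quarticResidueSymbol_eq hπ hodd h3 ?_
  simpa using dvd_add (h.trans (sub_dvd_pow_sub_pow _ _ (quarticExp π))) h4

theorem quarticResidueSymbol_associated {π π' : GaussianInt} (h : Associated π π')
    (a : GaussianInt) : quarticResidueSymbol a π = quarticResidueSymbol a π' := by
  have hd : ∀ b, π ∣ b ↔ π' ∣ b := fun b => h.dvd_iff_dvd_left
  have hn := Zsqrtd.norm_eq_of_associated (d := -1) (by norm_num) h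
  unfold quarticResidueSymbol
  rw [hn]
  classical
  exact if_congr (hd _) rfl
    (if_congr (hd _) rfl (if_congr (hd _) rfl (if_congr (hd _) rfl rfl)))

theorem quarticResidueSymbol_star {π : GaussianInt} (hπ : Prime π) (hodd : Odd π.norm)
    (a : GaussianInt) :
    quarticResidueSymbol (star a) (star π) = star (quarticResidueSymbol a π) := by
  obtain ⟨h1, h2⟩ := dvd_pow_quarticExp_sub hπ hodd a
  have hπ' : Prime (star π) := (MulEquiv.prime_iff (starMulAut : MulAut GaussianInt)).2 hπ
  refine quarticResidueSymbol_eq hπ' (by rwa [Zsqrtd.norm_conj]) (by rw [← star_pow, h1]) ?_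
  obtain ⟨s, hs⟩ := h2
  refine ⟨star s, ?_⟩
  rw [← star_mul', ← hs, star_sub, star_pow]
  unfold quarticExp
  rw [Zsqrtd.norm_conj]

theorem quarticResidueSymbol_pow_four {π : GaussianInt} (hπ : Prime π) (hodd : Odd π.norm)
    {a : GaussianInt} (h : ¬ π ∣ a) : quarticResidueSymbol a π ^ 4 = 1 := by
  obtain ⟨h1, h2⟩ := dvd_pow_quarticExp_sub hπ hodd a
  have hne : quarticResidueSymbol a π ≠ 0 := fun h0 => h (hπ.dvd_of_dvd_pow (by simpa [h0] using h2))
  refine mul_right_cancel₀ hne ?_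
  rw [one_mul, ← pow_succ, h1]

/-! ### The quartic Jacobi symbol: multiplicativity and the units -/

open UniqueFactorizationMonoid

theorem odd_norm_induction {P : ∀ b : GaussianInt, Odd b.norm → Prop}
    (hunit : ∀ u (_ : IsUnit u) h, P u h)
    (hmul : ∀ π a (_ : Prime π) (hπ : Odd π.norm) (ha : Odd a.norm), P a ha →
      P (π * a) (odd_norm_mul hπ ha)) (b : GaussianInt) (hb : Odd b.norm) : P b hb := by
  induction b using induction_on_prime with
  | h₁ => exact absurd rfl (ne_zero_of_odd_norm hb)
  | h₂ u hu => exact hunit u hu hb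
  | h₃ a π _ hπ ih =>
    have h := hb
    rw [Zsqrtd.norm_mul, Int.odd_mul] at h
    exact hmul π a hπ h.1 h.2 (ih h.2)

/-- Factorisations are unique only up to associates, so multiplicativity in the lower argument rests
on this invariance. -/
theorem quarticJacobiSymbol_of_rel {s t : Multiset GaussianInt}
    (h : Multiset.Rel Associated s t) (a : GaussianInt) :
    (s.map (quarticResidueSymbol a)).prod = (t.map (quarticResidueSymbol a)).prod := by
  induction h with
  | zero => rfl
  | cons h1 _ ih => simp [quarticResidueSymbol_associated h1, ih]

theorem quarticJacobiSymbol_associated {b c : GaussianInt} (h : Associated b c)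
    (a : GaussianInt) : quarticJacobiSymbol a b = quarticJacobiSymbol a c :=
  quarticJacobiSymbol_of_rel (factors_rel_of_associated h) a

theorem quarticJacobiSymbol_mul_right {b c : GaussianInt} (hb : b ≠ 0) (hc : c ≠ 0)
    (a : GaussianInt) : quarticJacobiSymbol a (b * c) =
      quarticJacobiSymbol a b * quarticJacobiSymbol a c := by
  unfold quarticJacobiSymbol
  rw [quarticJacobiSymbol_of_rel (factors_mul hb hc), Multiset.map_add, Multiset.prod_add]

theorem quarticJacobiSymbol_of_isUnit {u : GaussianInt} (hu : IsUnit u) (a : GaussianInt) :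
    quarticJacobiSymbol a u = 1 := by
  simp [quarticJacobiSymbol, factors_of_isUnit hu]

theorem quarticJacobiSymbol_of_prime {π : GaussianInt} (hπ : Prime π) (a : GaussianInt) :
    quarticJacobiSymbol a π = quarticResidueSymbol a π := by
  obtain ⟨b, hb, hf⟩ := factors_eq_singleton_of_irreducible hπ.irreducible
  simp [quarticJacobiSymbol, hf, quarticResidueSymbol_associated hb]

theorem quarticJacobiSymbol_prime_mul {π b : GaussianInt} (hπ : Prime π) (hb : Odd b.norm)
    (a : GaussianInt) : quarticJacobiSymbol a (π * b) =
      quarticResidueSymbol a π * quarticJacobiSymbol a b := by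
  rw [quarticJacobiSymbol_mul_right hπ.ne_zero (ne_zero_of_odd_norm hb),
    quarticJacobiSymbol_of_prime hπ]

theorem quarticJacobiSymbol_mul_left {c : GaussianInt} (hc : Odd c.norm) (a b : GaussianInt) :
    quarticJacobiSymbol (a * b) c = quarticJacobiSymbol a c * quarticJacobiSymbol b c := by
  induction c, hc using odd_norm_induction with
  | hunit u hu _ => simp [quarticJacobiSymbol_of_isUnit hu]
  | hmul π c hπ ho hc ih =>
    simp only [quarticJacobiSymbol_prime_mul hπ hc, quarticResidueSymbol_mul hπ ho, ih]
    ring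

theorem quarticJacobiSymbol_congr {c : GaussianInt} (hc : Odd c.norm) {a b : GaussianInt}
    (h : c ∣ a - b) : quarticJacobiSymbol a c = quarticJacobiSymbol b c := by
  induction c, hc using odd_norm_induction with
  | hunit u hu _ => simp [quarticJacobiSymbol_of_isUnit hu]
  | hmul π c hπ ho hc ih =>
    simp only [quarticJacobiSymbol_prime_mul hπ hc, ih (dvd_of_mul_left_dvd h),
      quarticResidueSymbol_congr hπ ho (dvd_of_mul_right_dvd h)]

theorem prime_star {π : GaussianInt} (hπ : Prime π) : Prime (star π) :=
  (MulEquiv.prime_iff (starMulAut : MulAut GaussianInt)).2 hπ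

theorem quarticJacobiSymbol_star {c : GaussianInt} (hc : Odd c.norm) (a : GaussianInt) :
    quarticJacobiSymbol (star a) (star c) = star (quarticJacobiSymbol a c) := by
  induction c, hc using odd_norm_induction with
  | hunit u hu _ => simp [quarticJacobiSymbol_of_isUnit hu, quarticJacobiSymbol_of_isUnit hu.star]
  | hmul π c hπ ho hc ih =>
    rw [quarticJacobiSymbol_prime_mul hπ hc, star_mul', star_mul',
      quarticJacobiSymbol_prime_mul (prime_star hπ) (by rwa [Zsqrtd.norm_conj]),
      quarticResidueSymbol_star hπ ho, ih]

theorem quarticJacobiSymbol_pow_left {c : GaussianInt} (hc : Odd c.norm) (a : GaussianInt)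
    (n : ℕ) (hn : n ≠ 0) : quarticJacobiSymbol (a ^ n) c = quarticJacobiSymbol a c ^ n := by
  induction n, Nat.one_le_iff_ne_zero.2 hn using Nat.le_induction with
  | base => simp
  | succ n h ih => rw [pow_succ, quarticJacobiSymbol_mul_left hc, ih (by omega), pow_succ]

theorem quarticJacobiSymbol_pow_four {c a : GaussianInt} (hc : Odd c.norm)
    (h : IsCoprime a c) : quarticJacobiSymbol a c ^ 4 = 1 := by
  induction c, hc using odd_norm_induction with
  | hunit u hu _ => simp [quarticJacobiSymbol_of_isUnit hu]
  | hmul π c hπ ho hc ih =>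
    rw [IsCoprime.mul_right_iff] at h
    rw [quarticJacobiSymbol_prime_mul hπ hc, mul_pow, ih h.2, mul_one]
    exact quarticResidueSymbol_pow_four hπ ho
      fun hd => hπ.not_isUnit (h.1.symm.isUnit_of_dvd' dvd_rfl hd)

theorem quarticJacobiSymbol_ne_zero {c a : GaussianInt} (hc : Odd c.norm)
    (h : IsCoprime a c) : quarticJacobiSymbol a c ≠ 0 := fun h0 => by
  simpa [h0] using quarticJacobiSymbol_pow_four hc h

theorem quarticJacobiSymbol_one_left {c : GaussianInt} (hc : Odd c.norm) :
    quarticJacobiSymbol 1 c = 1 := by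
  refine mul_left_cancel₀ (quarticJacobiSymbol_ne_zero hc isCoprime_one_left) ?_
  rw [← quarticJacobiSymbol_mul_left hc, mul_one, mul_one]

theorem quarticJacobiSymbol_imUnit {c : GaussianInt} (hc : Odd c.norm) :
    quarticJacobiSymbol imUnit c = imUnit ^ quarticExp c := by
  induction c, hc using odd_norm_induction with
  | hunit u hu _ =>
    rw [quarticJacobiSymbol_of_isUnit hu, quarticExp, Zsqrtd.norm_eq_one_iff.2 hu]
    rfl
  | hmul π c hπ ho hc ih =>
    have h4 : imUnit ^ 4 = 1 := by decide
    rw [quarticJacobiSymbol_prime_mul hπ hc, ih, quarticResidueSymbol_eq hπ ho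
      (u := imUnit ^ quarticExp π) (by rw [← pow_mul, mul_comm, pow_mul]; congr 1) (by simp)]
    have h1 := four_mul_quarticExp ho
    have h2 := four_mul_quarticExp hc
    have h3 := four_mul_quarticExp (odd_norm_mul ho hc)
    rw [Zsqrtd.norm_mul, Int.natAbs_mul, ← h1, ← h2] at h3
    -- (NM - 1)/4 is additive in N and M modulo 4: with N = 4e + 1 and M = 4e' + 1 it equals e + e'
    -- + 4ee'.
    have h5 : quarticExp (π * c) = quarticExp π + quarticExp c +
        4 * (quarticExp π * quarticExp c) := by nlinarith
    rw [h5, pow_add _ _ (4 * _), pow_mul, h4, one_pow, mul_one, pow_add]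

theorem quarticJacobiSymbol_neg_one {c : GaussianInt} (hc : Odd c.norm) :
    quarticJacobiSymbol (-1) c = (-1) ^ quarticExp c := by
  rw [← imUnit_sq, quarticJacobiSymbol_pow_left hc _ _ two_ne_zero,
    quarticJacobiSymbol_imUnit hc, ← pow_mul, ← pow_mul, mul_comm]

theorem quarticJacobiSymbol_neg_left {c : GaussianInt} (hc : Odd c.norm) (a : GaussianInt) :
    quarticJacobiSymbol (-a) c = (-1) ^ quarticExp c * quarticJacobiSymbol a c := by
  rw [← quarticJacobiSymbol_neg_one hc, ← quarticJacobiSymbol_mul_left hc, neg_one_mul]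

/-! ### Symbols of rational integers -/

theorem odd_norm_intCast {n : ℤ} : Odd (n : GaussianInt).norm ↔ Odd n := by
  rw [Zsqrtd.norm_intCast, Int.odd_mul, and_self]

/-- For n = 2k + 1 the exponent is k(k + 1). Consequently -1 has symbol 1 modulo n. -/
theorem quarticExp_intCast_even {n : ℤ} (hn : Odd n) : Even (quarticExp n) := by
  have h1 := four_mul_quarticExp (odd_norm_intCast.2 hn)
  obtain ⟨k, rfl⟩ := hn
  rw [Zsqrtd.norm_intCast] at h1
  have h2 : (4 * quarticExp ((2 * k + 1 : ℤ) : GaussianInt) + 1 : ℤ) = 4 * (k * (k + 1)) + 1 := by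
    have := Int.natAbs_mul_self' (2 * k + 1)
    rw [Int.natAbs_mul] at h1
    have h1' := congrArg (Nat.cast : ℕ → ℤ) h1
    rw [Nat.cast_mul, this] at h1'
    push_cast at h1' ⊢
    linear_combination h1'
  have h3 : (quarticExp ((2 * k + 1 : ℤ) : GaussianInt) : ℤ) = k * (k + 1) := by linarith
  have := Int.even_mul_succ_self k
  rw [← h3] at this
  exact_mod_cast this

theorem quarticJacobiSymbol_neg_left_intCast {n : ℤ} (hn : Odd n) (a : GaussianInt) :
    quarticJacobiSymbol (-a) n = quarticJacobiSymbol a n := by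
  rw [quarticJacobiSymbol_neg_left (odd_norm_intCast.2 hn), (quarticExp_intCast_even hn).neg_one_pow,
    one_mul]

theorem associated_neg (a : GaussianInt) : Associated a (-a) := ⟨-1, by simp⟩

theorem quarticJacobiSymbol_neg_right (a b : GaussianInt) :
    quarticJacobiSymbol a (-b) = quarticJacobiSymbol a b :=
  quarticJacobiSymbol_associated (associated_neg b).symm a

theorem star_intCast (n : ℤ) : star (n : GaussianInt) = n := by ext <;> simp

theorem isCoprime_intCast {m n : ℤ} (h : IsCoprime m n) :
    IsCoprime (m : GaussianInt) (n : GaussianInt) := h.map (Int.castRingHom GaussianInt)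

theorem prime_of_norm_eq {p : ℕ} [hp : Fact p.Prime] {π : GaussianInt} (hn : π.norm = p) :
    Prime π := by
  refine Irreducible.prime ⟨fun hu => ?_, fun x y hxy => ?_⟩
  · have := Zsqrtd.norm_eq_one_iff.2 hu
    rw [hn, Int.natAbs_natCast] at this
    exact hp.out.one_lt.ne' this
  · have := congrArg Zsqrtd.norm hxy
    rw [hn, Zsqrtd.norm_mul] at this
    have h3 : x.norm.natAbs * y.norm.natAbs = p := by
      rw [← Int.natAbs_mul, ← this, Int.natAbs_natCast]
    rcases (Nat.dvd_prime hp.out).1 (Dvd.intro _ h3) with h | h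
    · exact Or.inl (Zsqrtd.norm_eq_one_iff.1 h)
    · right
      rw [h] at h3
      exact Zsqrtd.norm_eq_one_iff.1 (Nat.eq_of_mul_eq_mul_left hp.out.pos (by rw [h3, mul_one]))

/-- A rational prime that is `1` modulo `4` is a norm of a Gaussian prime. -/
theorem exists_prime_mul_star {p : ℕ} [hp : Fact p.Prime] (h4 : p % 4 = 1) :
    ∃ π : GaussianInt, Prime π ∧ π.norm = p ∧ π * star π = p := by
  have h1 : ¬ Irreducible (p : GaussianInt) := fun h => by
    have := mod_four_eq_three_of_nat_prime_of_prime p (irreducible_iff_prime.1 h); omega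
  obtain ⟨a, b, hab⟩ := sq_add_sq_of_nat_prime_of_not_irreducible p h1
  have hn : Zsqrtd.norm (⟨(a : ℤ), (b : ℤ)⟩ : GaussianInt) = p := by
    rw [norm_eq, ← hab]; push_cast; rfl
  exact ⟨⟨a, b⟩, prime_of_norm_eq hn, hn,
    by rw [← Zsqrtd.norm_eq_mul_conj, hn, Int.cast_natCast]⟩

/-- If p splits, the symbols at its two conjugate factors are conjugate roots of unity, with product
1. If p is inert, the exponent (p² - 1)/4 is a multiple of p - 1 and Fermat applies. -/
theorem quarticJacobiSymbol_natCast_prime {p : ℕ} [hp : Fact p.Prime] (h2 : Odd p) {n : ℤ}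
    (h : IsCoprime n p) : quarticJacobiSymbol n (p : GaussianInt) = 1 := by
  have hodd : Odd (p : GaussianInt).norm := by
    rw [Zsqrtd.norm_natCast]; exact_mod_cast h2.mul h2
  have hcop : IsCoprime (n : GaussianInt) (p : GaussianInt) := by
    simpa using isCoprime_intCast h
  have h4 : p % 4 = 1 ∨ p % 4 = 3 := by obtain ⟨k, rfl⟩ := h2; omega
  rcases h4 with h4 | h4
  · obtain ⟨π, hπ, hn, hm⟩ := exists_prime_mul_star h4
    have ho : Odd π.norm := by rw [hn]; exact_mod_cast h2
    have hps := prime_star hπ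
    have h1 : IsCoprime (n : GaussianInt) π := hcop.of_isCoprime_of_dvd_right (Dvd.intro _ hm)
    have h5 : quarticJacobiSymbol (n : GaussianInt) (star π) =
        star (quarticJacobiSymbol (n : GaussianInt) π) := by
      rw [← quarticJacobiSymbol_star ho, star_intCast]
    rw [← hm, quarticJacobiSymbol_mul_right hπ.ne_zero hps.ne_zero, h5,
      mul_star_of_pow_four (quarticJacobiSymbol_pow_four ho h1)]
  · have hpr := prime_of_nat_prime_of_mod_four_eq_three p h4
    rw [quarticJacobiSymbol_of_prime hpr]
    refine quarticResidueSymbol_eq hpr hodd (by simp) ?_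
    have he : quarticExp (p : GaussianInt) = (p - 1) * ((p + 1) / 4) := by
      have h3 := four_mul_quarticExp hodd
      rw [Zsqrtd.norm_natCast, Int.natAbs_mul, Int.natAbs_natCast] at h3
      obtain ⟨k, hk⟩ : ∃ k, p = 4 * k + 3 := ⟨p / 4, by omega⟩
      rw [hk] at h3 ⊢
      rw [show (4 * k + 3 + 1) / 4 = k + 1 by omega, show 4 * k + 3 - 1 = 4 * k + 2 by omega]
      nlinarith
    have hf : (p : ℤ) ∣ n ^ (p - 1) - 1 :=
      (Int.ModEq.pow_card_sub_one_eq_one hp.out h).symm.dvd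
    have hf' := (Zsqrtd.intCast_dvd_intCast (d := -1) _ _).2
      (hf.trans (sub_dvd_pow_sub_pow (n ^ (p - 1)) 1 ((p + 1) / 4)))
    rw [he, pow_mul]
    simpa using hf'

theorem odd_int_induction {P : ∀ n : ℤ, Odd n → Prop} (h1 : P 1 odd_one)
    (hneg : ∀ n hn, P n hn → P (-n) (Odd.neg hn))
    (hmul : ∀ (p : ℕ) (n : ℤ) (_ : p.Prime) (hp : Odd (p : ℤ)) (hn : Odd n), P n hn →
      P (p * n) (hp.mul hn)) (n : ℤ) (hn : Odd n) : P n hn := by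
  have key : ∀ (m : ℕ) (hm : Odd (m : ℤ)), P m hm := fun m hm => by
    induction m using induction_on_primes with
    | zero => exact absurd hm (by simp)
    | one => exact_mod_cast h1
    | prime_mul p a hp ih =>
      have h := hm
      rw [Nat.cast_mul, Int.odd_mul] at h
      have := hmul p a hp h.1 h.2 (ih h.2)
      exact_mod_cast this
  obtain ⟨m, rfl | rfl⟩ := Int.eq_nat_or_neg n
  · exact key m hn
  · exact hneg _ _ (key m (by simpa using hn.neg))

theorem quarticJacobiSymbol_intCast_intCast {m n : ℤ} (hn : Odd n) (h : IsCoprime m n) :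
    quarticJacobiSymbol m n = 1 := by
  induction n, hn using odd_int_induction with
  | h1 => exact quarticJacobiSymbol_of_isUnit (by simp) _
  | hneg n hn ih =>
    rw [Int.cast_neg, quarticJacobiSymbol_neg_right, ih (by simpa using h.neg_right)]
  | hmul p n hp hpo hno ih =>
    have := Fact.mk hp
    rw [IsCoprime.mul_right_iff] at h
    rw [Int.cast_mul, Int.cast_natCast, quarticJacobiSymbol_mul_right (by simpa using hp.ne_zero)
      (ne_zero_of_odd_norm (odd_norm_intCast.2 hno)), quarticJacobiSymbol_natCast_prime (by exact_mod_cast hpo) h.1,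
      ih h.2, one_mul]

/-! ### Quartic character, Jacobi sum and Gauss sum modulo a split prime -/

open Finset

section SplitPrime

variable {p : ℕ} [hp : Fact p.Prime] {π : GaussianInt}

theorem natCast_re_ne_zero (hn : π.norm = p) : (π.re : ZMod p) ≠ 0 := by
  intro h
  rw [ZMod.intCast_zmod_eq_zero_iff_dvd] at h
  rw [norm_eq] at hn
  have hpp := Nat.prime_iff_prime_int.1 hp.out
  have h2 : (p : ℤ) ∣ π.im := by
    refine hpp.dvd_of_dvd_pow (n := 2) ?_
    rw [show π.im ^ 2 = p - π.re ^ 2 by linarith]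
    exact dvd_sub dvd_rfl (dvd_pow h two_ne_zero)
  have h3 : (p : ℤ) * p ∣ p * 1 := by
    rw [mul_one, ← sq]
    nth_rw 2 [← hn]
    exact dvd_add (pow_dvd_pow_of_dvd h 2) (pow_dvd_pow_of_dvd h2 2)
  exact hpp.not_isUnit (isUnit_of_dvd_one (Int.dvd_of_mul_dvd_mul_left hpp.ne_zero h3))

/-- Reduction modulo a Gaussian prime `π` whose norm is a rational prime. -/
theorem exists_ringHom_zmod (hπ : Prime π) (hn : π.norm = p) :
    ∃ f : GaussianInt →+* ZMod p, f imUnit = (π.im : ZMod p) / π.re ∧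
      ∀ a, f a = 0 ↔ π ∣ a := by
  have h0 := natCast_re_ne_zero hn
  have hs : (π.re : ZMod p) ^ 2 + (π.im : ZMod p) ^ 2 = 0 := by
    rw [norm_eq] at hn
    exact_mod_cast congrArg (Int.cast : ℤ → ZMod p) hn |>.trans (by simp)
  let f : GaussianInt →+* ZMod p := Zsqrtd.lift ⟨(π.im : ZMod p) / π.re, by
    field_simp; push_cast; linear_combination hs⟩
  have hfi : f imUnit = (π.im : ZMod p) / π.re := by simp [f]
  have hfπ : f π = 0 := by
    simp only [f, Zsqrtd.lift_apply_apply]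
    field_simp
    rw [hs, mul_zero]
  refine ⟨f, hfi, fun a => ⟨fun h => ?_, fun ⟨b, hb⟩ => by rw [hb, map_mul, hfπ, zero_mul]⟩⟩
  by_contra hd
  obtain ⟨u, v, huv⟩ := (hπ.irreducible.coprime_iff_not_dvd).2 hd
  have := congrArg f huv
  rw [map_add, map_mul, map_mul, h, hfπ, map_one] at this
  simp at this

variable (hπ : Prime π) (hn : π.norm = p) (hodd : Odd p)

omit hp in
theorem odd_norm_of_eq (hn : π.norm = p) (hodd : Odd p) : Odd π.norm := by rw [hn]; exact_mod_cast hodd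

omit hp in
theorem dvd_natCast_of_norm_eq (hn : π.norm = p) : π ∣ p := by
  rw [← Int.cast_natCast p, ← hn, Zsqrtd.norm_eq_mul_conj]
  exact dvd_mul_right _ _

theorem dvd_intCast_sub (hn : π.norm = p) {m n : ℤ} (h : (m : ZMod p) = n) :
    π ∣ (m : GaussianInt) - n := by
  refine (dvd_natCast_of_norm_eq hn).trans ?_
  have h1 := (ZMod.intCast_eq_intCast_iff_dvd_sub n m p).1 h.symm
  simpa using (Zsqrtd.intCast_dvd_intCast (d := -1) _ _).2 h1

theorem quarticResidueSymbol_val (hπ : Prime π) (hn : π.norm = p) (hodd : Odd p) (m : ℤ) :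
    quarticResidueSymbol (((m : ZMod p).val : ℤ) : GaussianInt) π =
      quarticResidueSymbol (m : GaussianInt) π :=
  quarticResidueSymbol_congr hπ (odd_norm_of_eq hn hodd) (dvd_intCast_sub hn (by simp))

/-- The quartic residue character modulo a Gaussian prime of prime norm. -/
noncomputable def quarticChar (hπ : Prime π) (hn : π.norm = p) (hodd : Odd p) :
    MulChar (ZMod p) GaussianInt where
  toFun a := quarticResidueSymbol ((a.val : ℤ) : GaussianInt) π
  map_one' := by
    have h := quarticResidueSymbol_val hπ hn hodd 1
    rw [Int.cast_one] at h
    rw [h]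
    exact quarticResidueSymbol_eq hπ (odd_norm_of_eq hn hodd) (by simp) (by simp)
  map_mul' a b := by
    have h := quarticResidueSymbol_val hπ hn hodd (a.val * b.val)
    have e : (((a.val : ℤ) * (b.val : ℤ) : ℤ) : ZMod p) = a * b := by simp
    rw [e, Int.cast_mul] at h
    rw [h, quarticResidueSymbol_mul hπ (odd_norm_of_eq hn hodd)]
  map_nonunit' a ha := by
    rw [isUnit_iff_ne_zero, not_not] at ha
    subst ha
    simp [quarticResidueSymbol]

theorem quarticChar_intCast (m : ℤ) :
    quarticChar hπ hn hodd m = quarticResidueSymbol m π :=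
  quarticResidueSymbol_val hπ hn hodd m

theorem exists_intCast_eq (a : ZMod p) : ∃ m : ℤ, a = m := ⟨a.val, by simp⟩

theorem quarticChar_pow_five (a : ZMod p) :
    quarticChar hπ hn hodd a ^ 5 = quarticChar hπ hn hodd a := by
  obtain ⟨m, rfl⟩ := exists_intCast_eq a
  rw [quarticChar_intCast]
  exact (dvd_pow_quarticExp_sub hπ (odd_norm_of_eq hn hodd) _).1

theorem quarticChar_ne_zero {a : ZMod p} (ha : a ≠ 0) : quarticChar hπ hn hodd a ≠ 0 :=
  ((isUnit_iff_ne_zero.2 ha).map (quarticChar hπ hn hodd)).ne_zero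

theorem quarticChar_apply_pow_four {a : ZMod p} (ha : a ≠ 0) :
    quarticChar hπ hn hodd a ^ 4 = 1 := by
  refine mul_right_cancel₀ (quarticChar_ne_zero hπ hn hodd ha) ?_
  rw [one_mul, ← pow_succ, quarticChar_pow_five]

theorem quarticChar_pow_four : quarticChar hπ hn hodd ^ 4 = 1 := by
  refine MulChar.ext fun a => ?_
  rw [MulChar.pow_apply' _ (by norm_num), quarticChar_apply_pow_four hπ hn hodd a.ne_zero,
    MulChar.one_apply_coe]

omit hp in
theorem quarticExp_of_norm_eq (hn : π.norm = p) (hodd : Odd p) : 4 * quarticExp π + 1 = p := by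
  rw [four_mul_quarticExp (odd_norm_of_eq hn hodd), hn, Int.natAbs_natCast]

theorem map_quarticChar {f : GaussianInt →+* ZMod p} (hf : ∀ a, f a = 0 ↔ π ∣ a) (a : ZMod p) :
    f (quarticChar hπ hn hodd a) = a ^ quarticExp π := by
  obtain ⟨m, rfl⟩ := exists_intCast_eq a
  rw [quarticChar_intCast]
  have := (hf _).2 (dvd_pow_quarticExp_sub hπ (odd_norm_of_eq hn hodd) m).2
  rw [map_sub, map_pow, map_intCast, sub_eq_zero] at this
  exact this.symm

/-- By Euler's criterion, any nonsquare works; so the square of the character is still nontrivial.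
-/
theorem exists_quarticChar_sq_eq_neg_one : ∃ a, quarticChar hπ hn hodd a ^ 2 = -1 := by
  obtain ⟨f, -, hf⟩ := exists_ringHom_zmod hπ hn
  have hp2 : p ≠ 2 := by rintro rfl; exact absurd hodd (by decide)
  obtain ⟨a, ha⟩ := FiniteField.exists_nonsquare (F := ZMod p) (by rwa [ZMod.ringChar_zmod_n])
  have ha0 : a ≠ 0 := by rintro rfl; exact ha (IsSquare.zero)
  refine ⟨a, ?_⟩
  have h4 := quarticChar_apply_pow_four hπ hn hodd ha0
  have h2 : (quarticChar hπ hn hodd a ^ 2 - 1) * (quarticChar hπ hn hodd a ^ 2 + 1) = 0 := by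
    linear_combination h4
  rcases mul_eq_zero.1 h2 with h | h
  · exfalso
    rw [ZMod.euler_criterion p ha0] at ha
    refine ha ?_
    have := congrArg f h
    rw [map_sub, map_pow, map_quarticChar hπ hn hodd hf, map_one, map_zero, ← pow_mul,
      sub_eq_zero] at this
    rw [← this]
    congr 1
    have := quarticExp_of_norm_eq hn hodd
    omega
  · exact eq_neg_of_add_eq_zero_left h

theorem mulChar_mul_self_apply {R R' : Type*} [CommMonoid R] [CommMonoidWithZero R']
    (χ : MulChar R R') (a : R) : (χ * χ) a = χ a ^ 2 := by
  rw [MulChar.mul_apply, sq]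

theorem quarticChar_ringHomComp_sq_ne_one {F : Type*} [Field F] (φ : GaussianInt →+* F)
    (h2 : (2 : F) ≠ 0) : (quarticChar hπ hn hodd).ringHomComp φ *
      (quarticChar hπ hn hodd).ringHomComp φ ≠ 1 := by
  obtain ⟨a, ha⟩ := exists_quarticChar_sq_eq_neg_one hπ hn hodd
  intro h
  have ha0 : a ≠ 0 := by
    rintro rfl
    rw [MulChar.map_zero] at ha
    exact absurd ha (by decide)
  have h1 := congrArg (fun χ => χ a) h
  simp only [mulChar_mul_self_apply, MulChar.ringHomComp_apply] at h1
  rw [← map_pow, ha, MulChar.one_apply (isUnit_iff_ne_zero.2 ha0), map_neg, map_one] at h1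
  exact h2 (by linear_combination -h1)

theorem quarticChar_ringHomComp_ne_one {F : Type*} [Field F] (φ : GaussianInt →+* F)
    (h2 : (2 : F) ≠ 0) : (quarticChar hπ hn hodd).ringHomComp φ ≠ 1 := fun h =>
  quarticChar_ringHomComp_sq_ne_one hπ hn hodd φ h2 (by rw [h, one_mul])

theorem star_quarticChar :
    (quarticChar hπ hn hodd).ringHomComp (starRingEnd GaussianInt) =
      (quarticChar hπ hn hodd)⁻¹ := by
  refine eq_inv_of_mul_eq_one_right ?_
  refine MulChar.ext fun a => ?_
  rw [MulChar.mul_apply, MulChar.ringHomComp_apply, MulChar.one_apply_coe]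
  exact mul_star_of_pow_four (quarticChar_apply_pow_four hπ hn hodd a.ne_zero)

theorem jacobiSum_quarticChar_mul_star :
    jacobiSum (quarticChar hπ hn hodd) (quarticChar hπ hn hodd) *
      star (jacobiSum (quarticChar hπ hn hodd) (quarticChar hπ hn hodd)) = p := by
  apply toComplex_injective
  have h := jacobiSum_mul_jacobiSum_inv (F := ZMod p) (F' := ℂ)
    (by rw [ringChar.eq_zero, ZMod.ringChar_zmod_n]; exact hp.out.ne_zero.symm)
    (quarticChar_ringHomComp_ne_one hπ hn hodd toComplex two_ne_zero)
    (quarticChar_ringHomComp_ne_one hπ hn hodd toComplex two_ne_zero)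
    (quarticChar_ringHomComp_sq_ne_one hπ hn hodd toComplex two_ne_zero)
  rw [MulChar.ringHomComp_inv, ← star_quarticChar, jacobiSum_ringHomComp, jacobiSum_ringHomComp,
    jacobiSum_ringHomComp, ZMod.card] at h
  rw [map_mul, map_natCast]
  exact h

/-- With e = (p - 1)/4, the Jacobi sum is modulo π the sum over a of a^e (1 - a)^e, a polynomial of
degree 2e < p - 1; power sums of such exponents vanish in `ZMod p`. -/
theorem dvd_jacobiSum_quarticChar :
    π ∣ jacobiSum (quarticChar hπ hn hodd) (quarticChar hπ hn hodd) := by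
  obtain ⟨f, -, hf⟩ := exists_ringHom_zmod hπ hn
  rw [← hf, jacobiSum, map_sum]
  simp only [map_mul, map_quarticChar hπ hn hodd hf]
  have he := quarticExp_of_norm_eq hn hodd
  have hpos := quarticExp_pos hπ (odd_norm_of_eq hn hodd)
  have h1 : ∀ a : ZMod p, a ^ quarticExp π * (1 - a) ^ quarticExp π =
      ∑ m ∈ range (quarticExp π + 1),
        (-1) ^ m * ((quarticExp π).choose m : ZMod p) * a ^ (m + quarticExp π) := fun a => by
    rw [sub_eq_neg_add, add_pow, mul_sum]
    refine sum_congr rfl fun m _ => ?_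
    rw [neg_pow a, one_pow, pow_add]
    ring
  simp only [h1]
  rw [sum_comm]
  refine sum_eq_zero fun m hm => ?_
  rw [← mul_sum, FiniteField.sum_pow_lt_card_sub_one, mul_zero]
  rw [ZMod.card]
  have := mem_range.1 hm
  omega

/-- The Jacobi sum J is divisible by π and has the same norm, so it is π times a unit. The
congruence J ≡ -1 modulo (i - 1)² makes its real part odd, leaving only J = ±π; the sign is
irrelevant after squaring. -/
theorem jacobiSum_quarticChar_sq (him : Even π.im) :
    jacobiSum (quarticChar hπ hn hodd) (quarticChar hπ hn hodd) ^ 2 = π ^ 2 := by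
  have hμ : IsPrimitiveRoot imUnit 4 := by
    refine IsPrimitiveRoot.mk_of_lt _ (by norm_num) (by decide) fun l hl hl4 => ?_
    interval_cases l <;> decide
  have h4 : 4 ∣ Fintype.card (ZMod p) - 1 := by
    rw [ZMod.card, ← quarticExp_of_norm_eq hn hodd]; simp
  obtain ⟨z, -, hz⟩ := exists_jacobiSum_eq_neg_one_add (by norm_num)
    (quarticChar_pow_four hπ hn hodd) (quarticChar_pow_four hπ hn hodd) h4 hμ
  have hstar := jacobiSum_quarticChar_mul_star hπ hn hodd
  obtain ⟨s, hs⟩ := dvd_jacobiSum_quarticChar hπ hn hodd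
  rw [hs] at hz hstar ⊢
  have hsu : IsUnit s := by
    have h1 : ((π * s).norm : GaussianInt) = (p : ℤ) := by
      rw [Zsqrtd.norm_eq_mul_conj, hstar, Int.cast_natCast]
    have h2 : (π * s).norm = p := Int.cast_injective h1
    rw [Zsqrtd.norm_mul, hn] at h2
    rw [← Zsqrtd.norm_eq_one_iff' (by norm_num)]
    exact mul_left_cancel₀ (by exact_mod_cast hp.out.ne_zero) (h2.trans (mul_one _).symm)
  have h2 : (imUnit - 1) ^ 2 = ⟨0, -2⟩ := by decide
  have hodd' : Odd (π * s).re := by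
    rw [hz, h2]
    simp only [Zsqrtd.re_add, Zsqrtd.re_mul, Zsqrtd.re_neg, Zsqrtd.re_one]
    exact ⟨z.im - 1, by ring⟩
  have him' : ¬ Odd π.im := Int.not_odd_iff_even.2 him
  rcases isUnit_iff_eq hsu with rfl | rfl | rfl | rfl
  · rw [mul_one]
  · rw [mul_neg_one, neg_sq]
  · simp [him'] at hodd'
  · simp [him'] at hodd'

include hπ hn hodd in
/-- The quartic Gauss sum in characteristic `r`. -/
theorem exists_gaussSum (him : Even π.im) {r : ℕ} [hr : Fact r.Prime]
    (hr2 : r ≠ 2) (hrp : r ≠ p) {F : Type*} [Field F] [IsAlgClosed F] [CharP F r]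
    (φ : GaussianInt →+* F) :
    ∃ g : F, g ≠ 0 ∧ g ^ 4 = φ π ^ 2 * p ∧
      (r % 4 = 1 → φ (quarticResidueSymbol r π) * g ^ r = g) ∧
      (r % 4 = 3 → φ (quarticResidueSymbol (-r) π) ^ 3 * (g ^ r * g) = p) := by
  have hp0 : (p : F) ≠ 0 := fun h =>
    hrp ((Nat.prime_dvd_prime_iff_eq hr.out hp.out).1 ((CharP.cast_eq_zero_iff F r p).1 h))
  have h20 : (2 : F) ≠ 0 := fun h => by
    have := (CharP.cast_eq_zero_iff F r 2).1 (by exact_mod_cast h)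
    exact hr2 ((Nat.prime_dvd_prime_iff_eq hr.out Nat.prime_two).1 this)
  have hpF : NeZero (p : F) := ⟨hp0⟩
  -- Algebraic closedness and r ≠ p provide the p-th roots of unity on which the additive character
  -- is built.
  obtain ⟨ζ, hζ⟩ := HasEnoughRootsOfUnity.exists_primitiveRoot F p
  have hψ := AddChar.zmodChar_primitive_of_primitive_root p hζ
  set ψ := AddChar.zmodChar p ((IsPrimitiveRoot.iff_def ζ p).mp hζ).left
  set χ := (quarticChar hπ hn hodd).ringHomComp φ with hχ
  have hχ1 : χ ≠ 1 := quarticChar_ringHomComp_ne_one hπ hn hodd φ h20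
  have hχ2 : χ * χ ≠ 1 := quarticChar_ringHomComp_sq_ne_one hπ hn hodd φ h20
  have hχ4 : χ ^ 4 = 1 := by
    rw [hχ, MulChar.ringHomComp_pow, quarticChar_pow_four, MulChar.ringHomComp_one]
  have hsq : χ (-1) ^ 2 = 1 := by rw [← map_pow]; simp
  have hq : (χ * χ).IsQuadratic := fun a => by
    rw [mulChar_mul_self_apply, hχ, MulChar.ringHomComp_apply, ← map_pow]
    rcases eq_zero_or_of_pow_five_eq (quarticChar_pow_five hπ hn hodd a) with h | h | h | h | h <;>
      rw [h] <;> simp [imUnit_sq]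
  have hcard : (Fintype.card (ZMod p) : F) = p := by rw [ZMod.card]
  have hru : IsUnit (r : ZMod p) := by
    rw [isUnit_iff_ne_zero, Ne, ZMod.natCast_eq_zero_iff]
    exact fun h => hrp ((Nat.prime_dvd_prime_iff_eq hp.out hr.out).1 h).symm
  have hfrob : gaussSum χ ψ ^ r = gaussSum (χ ^ r) (ψ.mulShift r) := by
    rw [gaussSum_frob, AddChar.pow_mulShift]
  have hshift : ∀ χ' : MulChar (ZMod p) F,
      χ' r * gaussSum χ' (ψ.mulShift r) = gaussSum χ' ψ := fun χ' => gaussSum_mulShift χ' ψ hru.unit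
  have hval : ∀ m : ℤ, χ m = φ (quarticResidueSymbol m π) := fun m => by
    rw [hχ, MulChar.ringHomComp_apply, quarticChar_intCast]
  refine ⟨gaussSum χ ψ, gaussSum_ne_zero_of_nontrivial (by rwa [hcard]) hχ1 hψ, ?_, ?_, ?_⟩
  -- g(χ)² = g(χ²) J(χ, χ), where χ² is quadratic with χ²(-1) = 1, so g(χ²)² = p.
  · have h1 := jacobiSum_mul_nontrivial hχ2 ψ
    have h2 := gaussSum_sq hχ2 hq hψ
    rw [hcard, mulChar_mul_self_apply, hsq, one_mul] at h2
    have h3 : jacobiSum χ χ ^ 2 = φ π ^ 2 := by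
      rw [hχ, jacobiSum_ringHomComp, ← map_pow, jacobiSum_quarticChar_sq hπ hn hodd him,
        map_pow]
    calc gaussSum χ ψ ^ 4 = (gaussSum χ ψ * gaussSum χ ψ) ^ 2 := by ring
      _ = gaussSum (χ * χ) ψ ^ 2 * jacobiSum χ χ ^ 2 := by rw [← h1, mul_pow]
      _ = _ := by rw [h2, h3, mul_comm]
  · intro h
    have hχr : χ ^ r = χ := by
      rw [← Nat.div_add_mod r 4, h, pow_add, pow_mul, hχ4, one_pow, one_mul, pow_one]
    have := hval r
    push_cast at this
    rw [← this, hfrob, hχr, hshift]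
  -- Now χ^r = χ⁻¹, and g(χ) g(χ⁻¹) = χ(-1) p; the factor χ(-1) is absorbed by evaluating the symbol
  -- at -r.
  · intro h
    have hχ3 : χ ^ 3 = χ⁻¹ := eq_inv_of_mul_eq_one_right (by rw [← pow_succ']; exact hχ4)
    have hχr : χ ^ r = χ⁻¹ := by
      rw [← Nat.div_add_mod r 4, h, pow_add, pow_mul, hχ4, one_pow, one_mul, hχ3]
    have := hval (-r)
    push_cast at this
    rw [← this, ← MulChar.pow_apply' _ (by norm_num), hχ3, hfrob, hχr, neg_eq_neg_one_mul, map_mul]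
    have h1 := hshift χ⁻¹
    have h2 := mul_gaussSum_inv_eq_gaussSum χ⁻¹ ψ
    have h3 := gaussSum_mul_gaussSum_eq_card hχ1 hψ
    have h4 : χ⁻¹ (-1) * χ⁻¹ (-1) = 1 := by rw [← map_mul]; simp
    rw [hcard] at h3
    rw [← h3]
    linear_combination (χ⁻¹ (-1) * gaussSum χ ψ) * (h1 - h2) +
      gaussSum χ ψ * gaussSum χ⁻¹ ψ⁻¹ * h4

end SplitPrime

/-! ### Quartic reciprocity -/

/-- Reduction modulo a Gaussian prime, followed by the embedding into an algebraic closure. -/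
theorem exists_ringHom_isAlgClosed {l : GaussianInt} (hl : Prime l) {r : ℕ} [hr : Fact r.Prime]
    (h : l ∣ r) : ∃ (F : Type) (_ : Field F) (_ : IsAlgClosed F) (_ : CharP F r)
      (φ : GaussianInt →+* F), ∀ a, φ a = 0 ↔ l ∣ a := by
  have hm : (Ideal.span {l}).IsMaximal :=
    PrincipalIdealRing.isMaximal_of_irreducible hl.irreducible
  let _ : Field (GaussianInt ⧸ Ideal.span {l}) := Ideal.Quotient.field _
  let φ : GaussianInt →+* AlgebraicClosure (GaussianInt ⧸ Ideal.span {l}) :=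
    (algebraMap (GaussianInt ⧸ Ideal.span {l}) _).comp (Ideal.Quotient.mk _)
  have hφ : ∀ a, φ a = 0 ↔ l ∣ a := fun a => by
    rw [RingHom.comp_apply, map_eq_zero, Ideal.Quotient.eq_zero_iff_dvd]
  refine ⟨AlgebraicClosure (GaussianInt ⧸ Ideal.span {l}), inferInstance, inferInstance, ?_, φ, hφ⟩
  refine (CharP.charP_iff_prime_eq_zero hr.out).2 ?_
  rw [← map_natCast φ, hφ]
  exact h

section

variable {p : ℕ} [hp : Fact p.Prime] {π : GaussianInt} (hπ : Prime π) (hn : π.norm = p)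
  (hodd : Odd p) (him : Even π.im) {r : ℕ} [hr : Fact r.Prime]

include hπ hn hodd him

/-- Write r = l l̄. Cancelling g in (r/π) g^r = g and using g⁴ = π³π̄ gives (π³π̄/l) = (r/π)³. Since
(π̄/l) is the conjugate, hence the cube, of (π/l̄), the left side is (π/r)³. -/
theorem quarticJacobiSymbol_natCast_of_mod_four_eq_one (hrp : r ≠ p) (h4 : r % 4 = 1) :
    quarticJacobiSymbol (r : GaussianInt) π = quarticJacobiSymbol π (r : GaussianInt) := by
  obtain ⟨l, hl, hln, hlr⟩ := exists_prime_mul_star (p := r) h4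
  have hro : Odd r := Nat.odd_iff.2 (by omega)
  have hlo := odd_norm_of_eq hln hro
  have hls := prime_star hl
  have hlso : Odd (star l).norm := by rwa [Zsqrtd.norm_conj]
  have hπo := odd_norm_of_eq hn hodd
  have hpr : IsCoprime (p : GaussianInt) (r : GaussianInt) := by
    have := (Nat.isCoprime_iff_coprime.2 ((Nat.coprime_primes hp.out hr.out).2 hrp.symm))
    simpa using isCoprime_intCast this
  have hπr : IsCoprime π (r : GaussianInt) :=
    hpr.of_isCoprime_of_dvd_left (dvd_natCast_of_norm_eq hn)
  have hpπ : (p : GaussianInt) = π * star π := by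
    rw [← Zsqrtd.norm_eq_mul_conj, hn, Int.cast_natCast]
  have ht1 : quarticJacobiSymbol π l ^ 4 = 1 :=
    quarticJacobiSymbol_pow_four hlo (hπr.of_isCoprime_of_dvd_right ⟨_, hlr.symm⟩)
  have ht2 : quarticJacobiSymbol π (star l) ^ 4 = 1 :=
    quarticJacobiSymbol_pow_four hlso
      (hπr.of_isCoprime_of_dvd_right ⟨_, by rw [mul_comm]; exact hlr.symm⟩)
  have hs : quarticJacobiSymbol (r : GaussianInt) π ^ 4 = 1 :=
    quarticJacobiSymbol_pow_four hπo hπr.symm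
  have ht2' : quarticJacobiSymbol (star π) l = star (quarticJacobiSymbol π (star l)) := by
    rw [← quarticJacobiSymbol_star hlso, star_star]
  obtain ⟨F, _, _, _, φ, hφ⟩ := exists_ringHom_isAlgClosed hl (r := r) ⟨_, hlr.symm⟩
  obtain ⟨g, hg0, hg4, hg, -⟩ := exists_gaussSum hπ hn hodd him (r := r) (by omega) hrp φ
  have he := quarticExp_of_norm_eq hln hro
  have key : quarticJacobiSymbol (π ^ 3 * star π) l =
      quarticJacobiSymbol (r : GaussianInt) π ^ 3 := by
    rw [quarticJacobiSymbol_of_prime hl, quarticJacobiSymbol_of_prime hπ]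
    rw [quarticJacobiSymbol_of_prime hπ] at hs
    refine quarticResidueSymbol_eq hl hlo (by
      rw [← pow_mul, mul_comm, pow_mul, (dvd_pow_quarticExp_sub hπ hπo _).1]) ?_
    have h1 := hg h4
    have hgr : g ^ r = (g ^ 4) ^ quarticExp l * g := by rw [← pow_mul, ← pow_succ, he]
    rw [hgr, hg4, ← mul_assoc] at h1
    have h2 := mul_right_cancel₀ hg0 (h1.trans (one_mul g).symm)
    have hs' := congrArg φ hs
    rw [map_pow, map_one] at hs'
    have h3 : φ π ^ 2 * (p : F) = φ (π ^ 3 * star π) := by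
      rw [← map_natCast φ, hpπ, ← map_pow, ← map_mul]; congr 1; ring
    rw [h3] at h2
    rw [← hφ, map_sub, map_pow, map_pow]
    linear_combination (φ (quarticResidueSymbol (r : GaussianInt) π)) ^ 3 * h2 -
      φ (π ^ 3 * star π) ^ quarticExp l * hs'
  rw [quarticJacobiSymbol_mul_left hlo, quarticJacobiSymbol_pow_left hlo _ _ three_ne_zero,
    ht2'] at key
  have hm := mul_star_of_pow_four ht2
  have hJ : quarticJacobiSymbol π (r : GaussianInt) =
      quarticJacobiSymbol π l * quarticJacobiSymbol π (star l) := by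
    rw [← hlr, quarticJacobiSymbol_mul_right hl.ne_zero hls.ne_zero]
  rw [hJ]
  generalize quarticJacobiSymbol π l = a at *
  generalize quarticJacobiSymbol π (star l) = b at *
  generalize quarticJacobiSymbol (r : GaussianInt) π = s at *
  have h3 : s ^ 3 = (a * b) ^ 3 := by
    rw [← key]
    linear_combination (-a ^ 3 * star b) * ht2 + a ^ 3 * b ^ 3 * hm
  calc s = s * s ^ 4 * s ^ 4 := by rw [hs]; ring
    _ = (s ^ 3) ^ 3 := by ring
    _ = (a ^ 4) ^ 2 * (b ^ 4) ^ 2 * (a * b) := by rw [h3]; ring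
    _ = a * b := by rw [ht1, ht2]; ring

theorem quarticJacobiSymbol_neg_natCast_of_mod_four_eq_three (hrp : r ≠ p) (h4 : r % 4 = 3) :
    quarticJacobiSymbol (-r : GaussianInt) π = quarticJacobiSymbol π (r : GaussianInt) := by
  have hl := prime_of_nat_prime_of_mod_four_eq_three r h4
  have hro : Odd r := Nat.odd_iff.2 (by omega)
  have hlo : Odd (r : GaussianInt).norm := by
    rw [Zsqrtd.norm_natCast]; exact_mod_cast hro.mul hro
  have hπo := odd_norm_of_eq hn hodd
  have hpr : IsCoprime (p : GaussianInt) (r : GaussianInt) := by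
    have := (Nat.isCoprime_iff_coprime.2 ((Nat.coprime_primes hp.out hr.out).2 hrp.symm))
    simpa using isCoprime_intCast this
  have hπr : IsCoprime π (r : GaussianInt) :=
    hpr.of_isCoprime_of_dvd_left (dvd_natCast_of_norm_eq hn)
  have hpπ : (p : GaussianInt) = π * star π := by
    rw [← Zsqrtd.norm_eq_mul_conj, hn, Int.cast_natCast]
  have hs : quarticJacobiSymbol (-r : GaussianInt) π ^ 4 = 1 :=
    quarticJacobiSymbol_pow_four hπo hπr.symm.neg_left
  obtain ⟨F, _, _, _, φ, hφ⟩ := exists_ringHom_isAlgClosed hl (r := r) dvd_rfl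
  obtain ⟨g, hg0, hg4, -, hg⟩ := exists_gaussSum hπ hn hodd him (r := r) (by omega) hrp φ
  have hφπ : φ π ≠ 0 := by
    rw [Ne, hφ]
    exact fun h => hl.not_isUnit (hπr.isUnit_of_dvd' h dvd_rfl)
  have hfr : φ (star π) = φ π ^ r := by
    have := (hφ _).2 (dvd_pow_sub r π (by omega))
    rw [if_neg (by omega), map_sub, map_pow, sub_eq_zero] at this
    exact this.symm
  have hpF : (p : F) = φ π * φ π ^ r := by rw [← hfr, ← map_mul, ← hpπ, map_natCast]
  rw [quarticJacobiSymbol_of_prime hl, quarticJacobiSymbol_of_prime hπ]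
  rw [quarticJacobiSymbol_of_prime hπ] at hs
  refine (quarticResidueSymbol_eq hl hlo (dvd_pow_quarticExp_sub hπ hπo _).1 ?_).symm
  obtain ⟨k, hk⟩ : ∃ k, r = 4 * k + 3 := ⟨r / 4, by omega⟩
  -- Since π̄ ≡ π^r modulo r, g⁴ is π^(r+3). This identity of exponents rewrites g^(r+1) as
  -- π^((r²-1)/4) p, and p cancels against the Gauss sum relation.
  have he : quarticExp (r : GaussianInt) + (r + 1) = (r + 3) * (k + 1) := by
    have h3 := four_mul_quarticExp hlo
    rw [Zsqrtd.norm_natCast, Int.natAbs_mul, Int.natAbs_natCast] at h3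
    generalize quarticExp (r : GaussianInt) = e at *
    subst hk
    nlinarith
  have h1 := hg h4
  have h2 : g ^ r * g = φ π ^ (quarticExp (r : GaussianInt)) * (p : F) := by
    rw [← pow_succ, show r + 1 = 4 * (k + 1) by omega, pow_mul, hg4, hpF, ← pow_succ', ← pow_add,
      ← pow_mul, ← pow_add, he]
    congr 1; ring
  have hp0 : (p : F) ≠ 0 := by rw [hpF]; exact mul_ne_zero hφπ (pow_ne_zero _ hφπ)
  rw [h2, ← mul_assoc] at h1
  have h5 := mul_right_cancel₀ hp0 (h1.trans (one_mul _).symm)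
  have hs' := congrArg φ hs
  rw [map_pow, map_one] at hs'
  rw [← hφ, map_sub, map_pow]
  linear_combination (φ (quarticResidueSymbol (-r : GaussianInt) π)) * h5 -
      φ π ^ quarticExp (r : GaussianInt) * hs'

end

theorem isCoprime_of_intCast {m n : ℤ} (h : IsCoprime (m : GaussianInt) (n : GaussianInt)) :
    IsCoprime m n := by
  rw [Int.isCoprime_iff_gcd_eq_one, ← Int.natAbs_natCast (Int.gcd m n), ← Int.isUnit_iff_natAbs_eq]
  have := h.isUnit_of_dvd' ((Zsqrtd.intCast_dvd_intCast _ _).2 (Int.gcd_dvd_left m n))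
    ((Zsqrtd.intCast_dvd_intCast _ _).2 (Int.gcd_dvd_right m n))
  rw [Zsqrtd.isUnit_iff_norm_isUnit, Zsqrtd.norm_intCast] at this
  exact isUnit_of_mul_isUnit_left this

theorem eq_intCast_of_im_eq_zero {a : GaussianInt} (h : a.im = 0) : a = (a.re : GaussianInt) := by
  ext <;> simp [h]

theorem quarticJacobiSymbol_comm_of_prime {π : GaussianInt} (hπ : Prime π) (hodd : Odd π.norm)
    (him : Even π.im) {r : ℕ} [hr : Fact r.Prime] {n : ℤ} (hn : n.natAbs = r)
    (h4 : n ≡ 1 [ZMOD 4]) (hcop : IsCoprime (n : GaussianInt) π) :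
    quarticJacobiSymbol n π = quarticJacobiSymbol π n := by
  have h4' : n % 4 = 1 := h4
  have hno : Odd n := Int.odd_iff.2 (by omega)
  obtain ⟨p, hp, hd, ⟨hp4, hpn⟩ | ⟨hp4, has⟩⟩ := prime_cases hπ hodd
  · have := Fact.mk hp
    have hpo : Odd p := Nat.odd_iff.2 (by omega)
    have hrp : r ≠ p := by
      rintro rfl
      refine hπ.not_isUnit (hcop.isUnit_of_dvd' ?_ dvd_rfl)
      refine hd.trans ?_
      rw [← Int.cast_natCast, Zsqrtd.intCast_dvd_intCast, ← hn]
      exact Int.natAbs_dvd.2 dvd_rfl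
    rcases Int.natAbs_eq n with h | h <;> rw [hn] at h <;> rw [h]
    · rw [Int.cast_natCast]
      exact quarticJacobiSymbol_natCast_of_mod_four_eq_one hπ hpn hpo him hrp (by omega)
    · rw [Int.cast_neg, Int.cast_natCast, quarticJacobiSymbol_neg_right]
      exact quarticJacobiSymbol_neg_natCast_of_mod_four_eq_three hπ hpn hpo him hrp (by omega)
  -- An inert π with even imaginary part is rational, and both symbols are then 1.
  · have him0 : π.im = 0 := by
      obtain ⟨u, hu⟩ := has
      have hu1 := isUnit_iff_eq u⁻¹.isUnit
      rw [← Units.eq_mul_inv_iff_mul_eq] at hu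
      rcases hu1 with h | h | h | h <;> rw [h] at hu <;> rw [hu] at him ⊢
      · simp
      · simp
      · rw [show ((p : GaussianInt) * imUnit).im = (p : ℤ) by simp, Int.even_iff] at him
        omega
      · rw [show ((p : GaussianInt) * -imUnit).im = -(p : ℤ) by simp, Int.even_iff] at him
        omega
    rw [eq_intCast_of_im_eq_zero him0] at hcop hodd ⊢
    have hc := isCoprime_of_intCast hcop
    rw [quarticJacobiSymbol_intCast_intCast (odd_norm_intCast.1 hodd) hc,
      quarticJacobiSymbol_intCast_intCast hno hc.symm]

theorem odd_re_of_even_im {a : GaussianInt} (ha : Odd a.norm) (h : Even a.im) : Odd a.re := by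
  rcases parity ha with h1 | h1
  · exact h1.1
  · exact absurd h1.2 (Int.not_odd_iff_even.2 h)

theorem exists_associated_even_im {a : GaussianInt} (ha : Odd a.norm) :
    ∃ b, Associated a b ∧ Odd b.norm ∧ Even b.im := by
  rcases parity ha with h | h
  · exact ⟨a, Associated.refl a, ha, h.2⟩
  · have hu : IsUnit imUnit := isUnit_of_pow_four (by decide)
    have has : Associated a (a * imUnit) := ⟨hu.unit, rfl⟩
    refine ⟨a * imUnit, has, ?_, by simpa using h.1⟩
    rwa [← Zsqrtd.norm_eq_of_associated (by norm_num) has]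

theorem eq_or_eq_neg_of_associated {a b : GaussianInt} (h : Associated a b) (ha : Odd a.norm)
    (him : Even a.im) (him' : Even b.im) : b = a ∨ b = -a := by
  obtain ⟨u, rfl⟩ := h
  have hre := odd_re_of_even_im ha him
  have : ¬ Even a.re := Int.not_even_iff_odd.2 hre
  rcases isUnit_iff_eq u.isUnit with h | h | h | h <;> rw [h] at him' ⊢
  · simp
  · simp
  · simp [this] at him'
  · simp [this] at him'

theorem even_im_mul {a b : GaussianInt} (ha : Even a.im) (hb : Even b.im) :
    Even (a * b).im := by
  rw [Zsqrtd.im_mul]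
  exact (hb.mul_left _).add (ha.mul_right _)

theorem quarticJacobiSymbol_comm_of_natAbs_prime {a : GaussianInt} (ha : Odd a.norm)
    (him : Even a.im) {r : ℕ} [hr : Fact r.Prime] {n : ℤ} (hn : n.natAbs = r)
    (h4 : n ≡ 1 [ZMOD 4]) (hcop : IsCoprime (n : GaussianInt) a) :
    quarticJacobiSymbol n a = quarticJacobiSymbol a n := by
  have h4' : n % 4 = 1 := h4
  have hno : Odd n := Int.odd_iff.2 (by omega)
  have hno' := odd_norm_intCast.2 hno
  -- The prime factors supplied by the induction need not have even imaginary part, so the claim is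
  -- made for every normalised associate, which is unique up to sign.
  suffices ∀ b, Associated a b → Even b.im → quarticJacobiSymbol n b = quarticJacobiSymbol b n from
    this a (Associated.refl a) him
  clear him
  induction a, ha using odd_norm_induction with
  | hunit u hu ho =>
    intro b hb him
    rw [← quarticJacobiSymbol_associated hb, quarticJacobiSymbol_of_isUnit hu]
    have h1 : Associated 1 b := (associated_one_iff_isUnit.2 hu).symm.trans hb
    rcases eq_or_eq_neg_of_associated h1 (by simp) (by simp) him with rfl | rfl
    · simpa using (quarticJacobiSymbol_intCast_intCast hno (m := 1) isCoprime_one_left).symm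
    · rw [quarticJacobiSymbol_neg_left_intCast hno]
      simpa using (quarticJacobiSymbol_intCast_intCast hno (m := 1) isCoprime_one_left).symm
  | hmul π c hπ ho hc ih =>
    intro b hb him
    rw [IsCoprime.mul_right_iff] at hcop
    obtain ⟨π', hππ', ho', him'⟩ := exists_associated_even_im ho
    obtain ⟨c', hcc', hc', hcim'⟩ := exists_associated_even_im hc
    have hπ' := hππ'.prime hπ
    have h1 := ih hcop.2 c' hcc' hcim'
    have h2 := quarticJacobiSymbol_comm_of_prime hπ' ho' him' hn h4
      (hcop.1.of_isCoprime_of_dvd_right hππ'.symm.dvd)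
    have h3 : quarticJacobiSymbol n (π' * c') = quarticJacobiSymbol (π' * c') n := by
      rw [quarticJacobiSymbol_mul_right hπ'.ne_zero (ne_zero_of_odd_norm hc'),
        quarticJacobiSymbol_mul_left hno', h1, h2]
    have has : Associated (π' * c') b := (hππ'.mul_mul hcc').symm.trans hb
    rcases eq_or_eq_neg_of_associated has (odd_norm_mul ho' hc') (even_im_mul him' hcim') him with
      rfl | rfl
    · exact h3
    · rw [quarticJacobiSymbol_neg_right, quarticJacobiSymbol_neg_left_intCast hno, h3]

/-- The law of quartic reciprocity between a rational integer that is `1` modulo `4` and a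
Gaussian integer that is `1` modulo `2`. -/
theorem quarticJacobiSymbol_comm {a : GaussianInt} (ha : Odd a.norm) (him : Even a.im) {n : ℤ}
    (h4 : n ≡ 1 [ZMOD 4]) (hcop : IsCoprime (n : GaussianInt) a) :
    quarticJacobiSymbol n a = quarticJacobiSymbol a n := by
  have h4' : n % 4 = 1 := h4
  have hno : Odd n := Int.odd_iff.2 (by omega)
  -- Signs are left free so that each rational prime factor can be replaced by the one of ±p that is
  -- 1 modulo 4.
  suffices ∀ m : ℤ, (m = n ∨ m = -n) → m ≡ 1 [ZMOD 4] →
    quarticJacobiSymbol m a = quarticJacobiSymbol a m from this n (Or.inl rfl) h4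
  clear h4 h4'
  induction n, hno using odd_int_induction with
  | h1 =>
    rintro m (rfl | rfl) h
    · rw [quarticJacobiSymbol_of_isUnit (u := ((1 : ℤ) : GaussianInt)) (by simp), Int.cast_one]
      exact quarticJacobiSymbol_one_left ha
    · exact absurd h (by decide)
  | hneg n hn ih =>
    intro m hm
    exact ih ((IsCoprime.neg_left_iff _ _).1 (by simpa only [Int.cast_neg] using hcop)) m (by rw [neg_neg] at hm; exact hm.symm)
  | hmul p n hp hpo hno ih =>
    have := Fact.mk hp
    rw [Int.cast_mul, IsCoprime.mul_left_iff] at hcop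
    intro m hm hm4
    have hsgn : ∀ k : ℤ, Odd k → ∃ k', (k' = k ∨ k' = -k) ∧ k' ≡ 1 [ZMOD 4] := fun k hk => by
      obtain ⟨t, rfl⟩ := hk
      have : (2 * t + 1) % 4 = 1 ∨ (2 * t + 1) % 4 = 3 := by omega
      rcases this with h | h
      · exact ⟨_, Or.inl rfl, h⟩
      · exact ⟨_, Or.inr rfl, show _ % _ = _ by omega⟩
    obtain ⟨p', hp', hp4⟩ := hsgn p hpo
    obtain ⟨n', hn', hn4⟩ := hsgn n hno
    have h1 := ih hcop.2 n' hn' hn4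
    have hpc : IsCoprime (p' : GaussianInt) a := by
      rcases hp' with rfl | rfl
      · exact hcop.1
      · rw [Int.cast_neg]; exact hcop.1.neg_left
    have h2 := quarticJacobiSymbol_comm_of_natAbs_prime ha him (r := p) (n := p')
      (by rcases hp' with rfl | rfl <;> simp) hp4 hpc
    have hmm : m = p' * n' := by
      have h3 : p' * n' ≡ 1 [ZMOD 4] := by simpa using hp4.mul hn4
      have h4 : m = p' * n' ∨ m = -(p' * n') := by
        rcases hp' with rfl | rfl <;> rcases hn' with rfl | rfl <;> rcases hm with rfl | rfl <;> simp
      rcases h4 with h | h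
      · exact h
      · have h3' : (p' * n') % 4 = 1 := h3
        have hm4' : m % 4 = 1 := hm4
        omega
    have ho1 : Odd p' := by rcases hp' with rfl | rfl <;> simpa using hpo
    have ho2 : Odd n' := by rcases hn' with rfl | rfl <;> simpa using hno
    rw [hmm, Int.cast_mul, quarticJacobiSymbol_mul_left ha, h1, h2,
      quarticJacobiSymbol_mul_right (ne_zero_of_odd_norm (odd_norm_intCast.2 ho1))
        (ne_zero_of_odd_norm (odd_norm_intCast.2 ho2))]

/-! ### Supplementary laws for i, -1 and 2 -/

theorem four_mul_quarticExp_intCast {a : GaussianInt} (ha : Odd a.norm) :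
    4 * (quarticExp a : ℤ) + 1 = a.norm := by
  rw [← abs_natCast_norm, ← four_mul_quarticExp ha]; push_cast; rfl

theorem imUnit_pow_two_mul (n : ℕ) : imUnit ^ (2 * n) = if Even n then 1 else -1 := by
  rw [pow_mul, imUnit_sq]
  split_ifs with h
  · exact h.neg_one_pow
  · exact (Nat.not_even_iff_odd.1 h).neg_one_pow

theorem quarticJacobiSymbol_imUnit_intCast {n : ℤ} (hn : Odd n) :
    quarticJacobiSymbol imUnit n = if n % 8 = 1 ∨ n % 8 = 7 then 1 else -1 := by
  have ho := odd_norm_intCast.2 hn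
  have he := four_mul_quarticExp_intCast ho
  obtain ⟨m, hm⟩ := quarticExp_intCast_even hn
  rw [quarticJacobiSymbol_imUnit ho, hm, ← two_mul, imUnit_pow_two_mul]
  rw [hm, Zsqrtd.norm_intCast] at he
  refine if_congr ?_ rfl rfl
  have h8 : n % 8 = 1 ∨ n % 8 = 3 ∨ n % 8 = 5 ∨ n % 8 = 7 := by
    rw [Int.odd_iff] at hn; omega
  rw [Nat.even_iff]
  push_cast at he
  have hdiv := Int.mul_ediv_add_emod n 8
  generalize n / 8 = t at hdiv
  rcases h8 with h | h | h | h <;> rw [h] at hdiv ⊢ <;> subst hdiv <;> ring_nf at he <;> omega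

section

variable {b : GaussianInt} (hb : Odd b.norm) (him : (4 : ℤ) ∣ b.im)

include hb him

omit hb in
theorem even_im_of_four_dvd : Even b.im := by
  obtain ⟨e, he⟩ := him; exact ⟨2 * e, by linarith⟩

theorem even_quarticExp_of_four_dvd_im : Even (quarticExp b) := by
  have h1 := four_mul_quarticExp_intCast hb
  have h2 := odd_re_of_even_im hb (even_im_of_four_dvd him)
  obtain ⟨e, he⟩ := him
  obtain ⟨t, ht⟩ := h2
  rw [norm_eq, he, ht] at h1
  have h3 : (quarticExp b : ℤ) = t * (t + 1) + 2 * (2 * e ^ 2) := by linarith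
  have h4 : Even (quarticExp b : ℤ) := by
    rw [h3]; exact (Int.even_mul_succ_self t).add (even_two_mul _)
  exact_mod_cast h4

theorem quarticJacobiSymbol_neg_left_of_four_dvd_im (a : GaussianInt) :
    quarticJacobiSymbol (-a) b = quarticJacobiSymbol a b := by
  rw [quarticJacobiSymbol_neg_left hb, (even_quarticExp_of_four_dvd_im hb him).neg_one_pow, one_mul]

/-- Here -1 has symbol 1 modulo b as well as modulo n, so the condition n ≡ 1 modulo 4 can be
dropped. -/
theorem quarticJacobiSymbol_comm_of_four_dvd_im {n : ℤ} (hn : Odd n)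
    (hcop : IsCoprime (n : GaussianInt) b) :
    quarticJacobiSymbol n b = quarticJacobiSymbol b n := by
  have h2 := even_im_of_four_dvd him
  have h4 : n % 4 = 1 ∨ (-n) % 4 = 1 := by rw [Int.odd_iff] at hn; omega
  rcases h4 with h4 | h4
  · exact quarticJacobiSymbol_comm hb h2 h4 hcop
  · have := quarticJacobiSymbol_comm hb h2 (n := -n) h4 (by rw [Int.cast_neg]; exact hcop.neg_left)
    rwa [Int.cast_neg, quarticJacobiSymbol_neg_left_of_four_dvd_im hb him,
      quarticJacobiSymbol_neg_right] at this

omit hb him in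
theorem isCoprime_intCast_of_norm {n : ℤ} (h : IsCoprime n b.norm) :
    IsCoprime (n : GaussianInt) b := by
  have h1 := isCoprime_intCast h
  rw [Zsqrtd.norm_eq_mul_conj] at h1
  exact (IsCoprime.mul_right_iff.1 h1).1

/-- The quartic character of `2` modulo a primitive Gaussian integer that is real modulo `4`. -/
theorem quarticJacobiSymbol_two (hcop : IsCoprime b.re b.im) :
    quarticJacobiSymbol 2 b = if Even (b.im / 4) then 1 else -1 := by
  have hre := odd_re_of_even_im hb (even_im_of_four_dvd him)
  have him2 := even_im_of_four_dvd him
  have hbn := norm_eq b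
  -- Modulo b one has b.re (1 + i) ≡ n, and modulo n one has b ≡ b.re (1 - i). Reciprocity thus
  -- evaluates (1 + i) modulo b, and squaring reaches 2 because (1 + i)² = 2i.
  set n := b.re + b.im with hn
  have hno : Odd n := hre.add_even him2
  have hreo := odd_norm_intCast.2 hre
  have hno' := odd_norm_intCast.2 hno
  have hren : IsCoprime b.re n := by
    have := hcop.add_mul_left_right 1
    rwa [mul_one, add_comm] at this
  have hc1 : IsCoprime (b.re : GaussianInt) b := by
    refine isCoprime_intCast_of_norm ?_
    rw [hbn]
    have := (hcop.pow_right (n := 2)).add_mul_left_right b.re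
    rwa [← sq, add_comm] at this
  have hc2 : IsCoprime (n : GaussianInt) b := by
    refine isCoprime_intCast_of_norm ?_
    have h2 : IsCoprime n (2 * b.re ^ 2) :=
      (Int.isCoprime_two_right.2 hno).mul_right hren.symm.pow_right
    have := h2.add_mul_left_right (b.im - b.re)
    rwa [show 2 * b.re ^ 2 + n * (b.im - b.re) = b.norm by rw [hbn, hn]; ring] at this
  have h1 : quarticJacobiSymbol b.re b = quarticJacobiSymbol imUnit b.re := by
    rw [quarticJacobiSymbol_comm_of_four_dvd_im hb him hre hc1,
      quarticJacobiSymbol_congr hreo (b := imUnit * b.im) ⟨1, by ext <;> simp⟩,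
      quarticJacobiSymbol_mul_left hreo, quarticJacobiSymbol_intCast_intCast hre hcop.symm, mul_one]
  have h2 : quarticJacobiSymbol n b = quarticJacobiSymbol (1 - imUnit) n := by
    rw [quarticJacobiSymbol_comm_of_four_dvd_im hb him hno hc2,
      quarticJacobiSymbol_congr hno' (b := b.re * (1 - imUnit)) ⟨imUnit, by
        ext <;> simp [hn]; ring⟩,
      quarticJacobiSymbol_mul_left hno', quarticJacobiSymbol_intCast_intCast hno hren, one_mul]
  have h3 : quarticJacobiSymbol b.re b * quarticJacobiSymbol (1 + imUnit) b =
      quarticJacobiSymbol n b := by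
    rw [← quarticJacobiSymbol_mul_left hb]
    refine quarticJacobiSymbol_congr hb ⟨imUnit, ?_⟩
    ext <;> simp [hn]
  rw [h1, h2] at h3
  have h4 : quarticJacobiSymbol imUnit (b.re : GaussianInt) ^ 2 = 1 := by
    rw [quarticJacobiSymbol_imUnit_intCast hre]; split_ifs <;> simp
  have h5 : quarticJacobiSymbol 2 b * quarticJacobiSymbol imUnit b =
      quarticJacobiSymbol imUnit n := by
    have e1 : (2 : GaussianInt) * imUnit = (1 + imUnit) ^ 2 := by decide
    have e2 : (1 - imUnit) ^ 2 = ((-2 : ℤ) : GaussianInt) * imUnit := by decide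
    have e3 : IsCoprime (-2) n := (Int.isCoprime_two_left.2 hno).neg_left
    rw [← quarticJacobiSymbol_mul_left hb, e1, quarticJacobiSymbol_pow_left hb _ _ two_ne_zero]
    calc _ = (quarticJacobiSymbol imUnit (b.re : GaussianInt) *
          quarticJacobiSymbol (1 + imUnit) b) ^ 2 := by rw [mul_pow, h4, one_mul]
      _ = _ := by
        rw [h3, ← quarticJacobiSymbol_pow_left hno' _ _ two_ne_zero, e2,
          quarticJacobiSymbol_mul_left hno', quarticJacobiSymbol_intCast_intCast hno e3, one_mul]
  have h6 : quarticJacobiSymbol imUnit b * quarticJacobiSymbol imUnit b = 1 := by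
    rw [quarticJacobiSymbol_imUnit hb, ← mul_pow, ← sq, imUnit_sq]
    exact (even_quarticExp_of_four_dvd_im hb him).neg_one_pow
  have h7 : quarticJacobiSymbol 2 b = imUnit ^ (quarticExp n + quarticExp b) := by
    rw [pow_add, ← quarticJacobiSymbol_imUnit hno', ← quarticJacobiSymbol_imUnit hb, ← h5,
      mul_assoc, h6, mul_one]
  obtain ⟨m, hm⟩ := (quarticExp_intCast_even hno).add (even_quarticExp_of_four_dvd_im hb him)
  rw [h7, hm, ← two_mul, imUnit_pow_two_mul]
  refine if_congr ?_ rfl rfl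
  have e1 := four_mul_quarticExp_intCast hb
  have e2 := four_mul_quarticExp_intCast hno'
  have e3 : (quarticExp (n : GaussianInt) : ℤ) + quarticExp b = m + m := by exact_mod_cast hm
  generalize quarticExp (n : GaussianInt) = N at e2 e3
  rw [hbn] at e1
  rw [Zsqrtd.norm_intCast, hn] at e2
  obtain ⟨e, he⟩ := him
  obtain ⟨t, ht⟩ := hre
  rw [he] at e1 e2 ⊢
  rw [ht] at e1 e2
  -- With b.re = 2t + 1 and b.im = 4e, half the exponent of i has the parity of e, as t(t + 1) is
  -- even.
  have e4 : (m : ℤ) = t * (t + 1) + e + 2 * (t * e + 2 * e ^ 2) := by linarith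
  rw [Int.mul_ediv_cancel_left _ (by norm_num), ← Int.even_coe_nat, e4, Int.even_add,
    Int.even_add (n := e)]
  simp [Int.even_mul_succ_self]

end

/-! ### The symbols attached to 4p = x² + qy² -/

/-- The coprimality facts behind a representation `4p = x² + qy²` with `p = c² + d²`. -/
theorem isCoprime_of_representation {p : ℕ} [hp : Fact p.Prime] {q c d x y : ℤ}
    (hq : Odd q) (hy : Odd y) (ha : Odd (x + 2 * c)) (hpq : ¬ (p : ℤ) ∣ q) (hpo : Odd p)
    (hcd : (p : ℤ) = c ^ 2 + d ^ 2) (hxy : 4 * (p : ℤ) = x ^ 2 + q * y ^ 2)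
    (hda : IsCoprime d (x + 2 * c)) :
    IsCoprime y p ∧ IsCoprime x p ∧ IsCoprime x (q * y ^ 2) ∧
      IsCoprime (x + 2 * c) (q * y ^ 2) := by
  have hpp := Nat.prime_iff_prime_int.1 hp.out
  have hcop : ∀ {n : ℤ}, ¬ (p : ℤ) ∣ n → IsCoprime n p := fun h =>
    ((Prime.coprime_iff_not_dvd hpp).2 h).symm
  have h4 : ∀ {n : ℤ}, Odd n → IsCoprime n 4 := fun h => by
    have := (Int.isCoprime_two_right.2 h).pow_right (n := 2)
    norm_num at this; exact this
  have hp4 : ¬ (p : ℤ) ∣ 4 := fun h => by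
    have h2 : (p : ℤ) ∣ 2 := hpp.dvd_of_dvd_pow (n := 2) (by norm_num; exact h)
    have h3 : p ∣ 2 := by exact_mod_cast h2
    rw [(Nat.prime_dvd_prime_iff_eq hp.out Nat.prime_two).1 h3] at hpo
    exact absurd hpo (by decide)
  have hyp : ¬ (p : ℤ) ∣ y := fun h => by
    have h1 : (p : ℤ) ∣ x := by
      refine hpp.dvd_of_dvd_pow (n := 2) ?_
      rw [show x ^ 2 = 4 * p - q * y ^ 2 by linarith]
      exact dvd_sub (dvd_mul_left _ _) ((dvd_pow h two_ne_zero).mul_left _)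
    have h2 : (p : ℤ) * p ∣ p * 4 := by
      rw [mul_comm (p : ℤ) 4, hxy, ← sq]
      exact dvd_add (pow_dvd_pow_of_dvd h1 2) ((pow_dvd_pow_of_dvd h 2).mul_left _)
    exact hp4 (Int.dvd_of_mul_dvd_mul_left hpp.ne_zero h2)
  have hxp : ¬ (p : ℤ) ∣ x := fun h => by
    have h1 : (p : ℤ) ∣ q * y ^ 2 := by
      rw [show q * y ^ 2 = 4 * p - x ^ 2 by linarith]
      exact dvd_sub (dvd_mul_left _ _) (dvd_pow h two_ne_zero)
    rcases hpp.dvd_or_dvd h1 with h | h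
    · exact hpq h
    · exact hyp (hpp.dvd_of_dvd_pow h)
  refine ⟨hcop hyp, hcop hxp, ?_, ?_⟩
  · refine IsCoprime.mul_right ?_ (IsCoprime.pow_right ?_)
    · have h1 : IsCoprime q (x ^ 2 + q * y ^ 2) := hxy ▸ (h4 hq).mul_right (hcop hpq)
      exact ((IsCoprime.pow_right_iff two_pos).1 h1.of_add_mul_left_right).symm
    · have h1 : IsCoprime y (x ^ 2 + y * (q * y)) := by
        rw [show x ^ 2 + y * (q * y) = 4 * p by rw [hxy]; ring]
        exact (h4 hy).mul_right (hcop hyp)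
      exact ((IsCoprime.pow_right_iff two_pos).1 h1.of_add_mul_left_right).symm
  · have h1 : IsCoprime (x + 2 * c) (4 * d ^ 2) := (h4 ha).mul_right hda.symm.pow_right
    -- 4d² = 4p - 4c² turns the coprimality of x + 2c with d into coprimality with qy².
    rw [show 4 * d ^ 2 = q * y ^ 2 + (x + 2 * c) * (x - 2 * c) by linear_combination hxy - 4 * hcd]
      at h1
    exact h1.of_add_mul_left_right

/-- Everything is read off the norm relation qy² ≡ -2xa modulo b = x + 2π, flipping each symbol by
reciprocity. As d is even, 4 divides the imaginary part 2d of b, so no sign conditions intervene. -/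
theorem quarticJacobiSymbol_representation {p : ℕ} [hp : Fact p.Prime] (hp4 : p % 4 = 1)
    {q c d x y : ℤ} (hq : q % 8 = 3) (hpq : ¬ (p : ℤ) ∣ q)
    (hcd : (p : ℤ) = c ^ 2 + d ^ 2) (hxy : 4 * (p : ℤ) = x ^ 2 + q * y ^ 2)
    (hy : y % 4 = 1) (hx : Odd x) (hd : Even d)
    (hda : IsCoprime d (x + 2 * c)) :
    quarticJacobiSymbol ⟨-2 * d, x + 2 * c⟩ q * quarticJacobiSymbol y ⟨c, d⟩ =
      -((if Even (d / 2) then 1 else -1) *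
        (if (x + 2 * c) % 8 = 1 ∨ (x + 2 * c) % 8 = 7 then 1 else -1) *
        quarticJacobiSymbol ⟨c, d⟩ x) := by
  have hqo : Odd q := Int.odd_iff.2 (by omega)
  have hyo : Odd y := Int.odd_iff.2 (by omega)
  have hao : Odd (x + 2 * c) := hx.add_even (even_two_mul c)
  have hpo : Odd p := Nat.odd_iff.2 (by omega)
  obtain ⟨hyp, hxp, hxqy, haqy⟩ :=
    isCoprime_of_representation hqo hyo hao hpq hpo hcd hxy hda
  set a := x + 2 * c with ha
  set π : GaussianInt := ⟨c, d⟩ with hπ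
  set b : GaussianInt := ⟨a, 2 * d⟩ with hb
  have hπn : π.norm = p := by rw [norm_eq, hcd]
  have hπo : Odd π.norm := by rw [hπn]; exact_mod_cast hpo
  have hbn : b.norm = a ^ 2 + 4 * d ^ 2 := by rw [norm_eq]; simp only [hb]; ring
  have hbn' : b.norm = 2 * x * a + q * y ^ 2 := by
    rw [hbn, ha]; linear_combination hxy - 4 * hcd
  have hbo : Odd b.norm := by
    rw [hbn]; exact hao.pow.add_even ⟨2 * d ^ 2, by ring⟩
  have him : (4 : ℤ) ∣ b.im := by
    obtain ⟨e, rfl⟩ := hd; exact ⟨e, by simp only [hb]; ring⟩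
  have hqO := odd_norm_intCast.2 hqo
  have hyO := odd_norm_intCast.2 hyo
  have hxO := odd_norm_intCast.2 hx
  have haO := odd_norm_intCast.2 hao
  have ha2 : IsCoprime a 2 := Int.isCoprime_two_right.2 hao
  obtain ⟨haq, hay⟩ := IsCoprime.mul_right_iff.1 haqy
  have hay := (IsCoprime.pow_right_iff two_pos).1 hay
  obtain ⟨hxq, hxy'⟩ := IsCoprime.mul_right_iff.1 hxqy
  have hxy' := (IsCoprime.pow_right_iff two_pos).1 hxy'
  have h2xa : ∀ {n : ℤ}, Odd n → IsCoprime x n → IsCoprime a n → IsCoprime n (2 * x * a) :=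
    fun h h1 h2 => ((Int.isCoprime_two_right.2 h).mul_right h1.symm).mul_right h2.symm
  have hyb : IsCoprime (y : GaussianInt) b := isCoprime_intCast_of_norm (by
    rw [hbn', show q * y ^ 2 = y * (q * y) by ring]
    exact (h2xa hyo hxy' hay).add_mul_left_right _)
  have hqb : IsCoprime (q : GaussianInt) b := isCoprime_intCast_of_norm (by
    rw [hbn']
    exact (h2xa hqo hxq haq).add_mul_left_right _)
  have hxb : IsCoprime (x : GaussianInt) b := isCoprime_intCast_of_norm (by
    rw [hbn', show 2 * x * a + q * y ^ 2 = q * y ^ 2 + x * (2 * a) by ring]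
    exact hxqy.add_mul_left_right _)
  have hab : IsCoprime (a : GaussianInt) b := isCoprime_intCast_of_norm (by
    rw [hbn', show 2 * x * a + q * y ^ 2 = q * y ^ 2 + a * (2 * x) by ring]
    exact haqy.add_mul_left_right _)
  have hbb : b * star b = 2 * x * a + q * y ^ 2 := by
    rw [← Zsqrtd.norm_eq_mul_conj, hbn']; push_cast; ring
  -- b² = 4aπ - qy², so modulo y the square of b is π up to a rational factor.
  have e1 : quarticJacobiSymbol y π = quarticJacobiSymbol y b ^ 2 := by
    have h4a : IsCoprime (4 * a) y := IsCoprime.mul_left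
      (by simpa using (Int.isCoprime_two_left.2 hyo).pow_left (m := 2)) hay
    rw [quarticJacobiSymbol_comm hπo hd hy (isCoprime_intCast_of_norm (by rwa [hπn])),
      quarticJacobiSymbol_comm_of_four_dvd_im hbo him hyo hyb,
      ← quarticJacobiSymbol_pow_left hyO _ _ two_ne_zero,
      quarticJacobiSymbol_congr hyO (a := b ^ 2) (b := (4 * a : ℤ) * π) ⟨-(q * y), by
        ext
        · simp [sq, hπ, hb, ha]; linear_combination 4 * hcd - hxy
        · simp [sq, hπ, hb, ha]; ring⟩,
      quarticJacobiSymbol_mul_left hyO, quarticJacobiSymbol_intCast_intCast hyo h4a, one_mul]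
  have e2 : quarticJacobiSymbol q b * quarticJacobiSymbol y b ^ 2 =
      quarticJacobiSymbol 2 b * quarticJacobiSymbol x b * quarticJacobiSymbol a b := by
    rw [← quarticJacobiSymbol_pow_left hbo _ _ two_ne_zero, ← quarticJacobiSymbol_mul_left hbo,
      ← quarticJacobiSymbol_mul_left hbo, ← quarticJacobiSymbol_mul_left hbo,
      ← quarticJacobiSymbol_neg_left_of_four_dvd_im hbo him (2 * x * a)]
    exact quarticJacobiSymbol_congr hbo ⟨star b, by rw [hbb]; ring⟩
  have e3 : quarticJacobiSymbol a b = quarticJacobiSymbol imUnit a := by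
    have h2d : IsCoprime (2 * d) a := ha2.symm.mul_left hda
    rw [quarticJacobiSymbol_comm_of_four_dvd_im hbo him hao hab,
      quarticJacobiSymbol_congr haO (b := imUnit * (2 * d : ℤ)) ⟨1, by ext <;> simp [hb]⟩,
      quarticJacobiSymbol_mul_left haO, quarticJacobiSymbol_intCast_intCast hao h2d, mul_one]
  have e4 : quarticJacobiSymbol x b = quarticJacobiSymbol π x := by
    rw [quarticJacobiSymbol_comm_of_four_dvd_im hbo him hx hxb,
      quarticJacobiSymbol_congr hxO (b := (2 : ℤ) * π) ⟨1, by ext <;> simp [hb, hπ, ha]⟩,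
      quarticJacobiSymbol_mul_left hxO,
      quarticJacobiSymbol_intCast_intCast hx (Int.isCoprime_two_left.2 hx), one_mul]
  -- The minus sign is (i/q) for q ≡ 3 modulo 8.
  have e5 : quarticJacobiSymbol ⟨-2 * d, a⟩ q = -quarticJacobiSymbol q b := by
    have : (⟨-2 * d, a⟩ : GaussianInt) = imUnit * b := by ext <;> simp [hb]
    rw [this, quarticJacobiSymbol_mul_left hqO, quarticJacobiSymbol_imUnit_intCast hqo,
      if_neg (by omega), quarticJacobiSymbol_comm_of_four_dvd_im hbo him hqo hqb, neg_one_mul]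
  have e6 : quarticJacobiSymbol 2 b = if Even (d / 2) then 1 else -1 := by
    rw [quarticJacobiSymbol_two hbo him (by exact ha2.mul_right hda.symm)]
    rw [show b.im / 4 = d / 2 by simp only [hb]; omega]
  rw [e1, e5, ← e6, ← quarticJacobiSymbol_imUnit_intCast hao, neg_mul, e2, e3, e4]
  ring

/-! ### Passage to `ZMod p` and the theorem -/

theorem zpow_eq_pow_toNat_emod {K : Type*} [Field K] {w : K} (h : w ^ 4 = 1) (k : ℤ) :
    w ^ k = w ^ (k % 4).toNat := by
  have hw : w ≠ 0 := by rintro rfl; simp at h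
  have hk : ((k % 4).toNat : ℤ) = k % 4 := Int.toNat_of_nonneg (by omega)
  rw [← zpow_natCast, hk]
  nth_rw 1 [← Int.mul_ediv_add_emod k 4]
  rw [zpow_add₀ hw, zpow_mul, show w ^ (4 : ℤ) = 1 by exact_mod_cast h, one_zpow, one_mul]

theorem map_eq_zpow_of_toComplex_eq {K : Type*} [Field K] (f : GaussianInt →+* K)
    {u : GaussianInt} {k : ℤ} (h : toComplex u = Complex.I ^ k) : f u = f imUnit ^ k := by
  have hu : u = imUnit ^ (k % 4).toNat := by
    apply toComplex_injective
    rw [h, map_pow, show toComplex imUnit = Complex.I by simp [toComplex_def],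
      zpow_eq_pow_toNat_emod Complex.I_pow_four]
  have h4 : f imUnit ^ 4 = 1 := by
    rw [← map_pow, show imUnit ^ 4 = 1 by decide, map_one]
  rw [hu, map_pow, zpow_eq_pow_toNat_emod h4]

/-- Clearing the denominator multiplies the upper argument by a rational integer prime to q, whose
symbol is 1. -/
theorem quarticJacobiSymbolRat_div {m n q : ℤ} (hq : Odd q) (hn : n ≠ 0) (hnq : IsCoprime n q) :
    quarticJacobiSymbolRat ((m : ℚ) / n) q = quarticJacobiSymbol ⟨m, n⟩ q := by
  set r : ℚ := (m : ℚ) / n with hr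
  have hden : (r.den : ℤ) ∣ n := by
    rw [hr, ← Rat.divInt_eq_div]; exact Rat.den_dvd m n
  obtain ⟨e, he⟩ := hden
  have hdq : IsCoprime (r.den : ℤ) q := hnq.of_isCoprime_of_dvd_left ⟨e, he⟩
  have hnum : e * r.num = m := by
    have h1 : r * n = m := by rw [hr]; field_simp
    have h2 : r * r.den = r.num := Rat.mul_den_eq_num r
    have : (e * r.num : ℚ) = m := by
      rw [← h2, ← h1, he]; push_cast; ring
    exact_mod_cast this
  have hspec := (ratResidue_spec r q (Int.isCoprime_iff_gcd_eq_one.1 hdq)).symm.dvd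
  have hd : q ∣ n * ratResidue r q - m := by
    rw [he, ← hnum, show (r.den : ℤ) * e * ratResidue r q - e * r.num =
      e * (r.den * ratResidue r q - r.num) by ring]
    exact hspec.mul_left e
  have hqO := odd_norm_intCast.2 hq
  unfold quarticJacobiSymbolRat
  rw [← Zsqrtd.intCast_val, ← one_mul (quarticJacobiSymbol ⟨ratResidue r q, 1⟩ q),
    ← quarticJacobiSymbol_intCast_intCast hq hnq, ← quarticJacobiSymbol_mul_left hqO]
  refine quarticJacobiSymbol_congr hqO ?_
  rw [Zsqrtd.intCast_dvd]
  simpa using hd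

theorem map_quarticJacobiSymbol {p : ℕ} [Fact p.Prime] {π : GaussianInt} (hπ : Prime π)
    (hodd : Odd π.norm) {f : GaussianInt →+* ZMod p} (hf : ∀ a, f a = 0 ↔ π ∣ a) (n : ℤ) :
    f (quarticJacobiSymbol n π) = (n : ZMod p) ^ quarticExp π := by
  have := (hf _).2 (dvd_pow_quarticExp_sub hπ hodd n).2
  rw [map_sub, map_pow, map_intCast, sub_eq_zero] at this
  rw [quarticJacobiSymbol_of_prime hπ, ← this]

end GaussianInt

open GaussianInt in
theorem theorem3p2 (p : ℕ) [Fact p.Prime] (hp : p % 4 = 1)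
    (q c d x y k : ℤ) (hq : q ≡ 3 [ZMOD 8]) (hpq : ¬ (p : ℤ) ∣ q)
    (hcd : (p : ℤ) = c ^ 2 + d ^ 2) (hxy : 4 * (p : ℤ) = x ^ 2 + q * y ^ 2)
    (hc : c ≡ 1 [ZMOD 4]) (hy : y ≡ 1 [ZMOD 4])
    (hgcd : Int.gcd d (x + 2 * c) = 1)
    (hk : GaussianInt.toComplex
      (quarticJacobiSymbolRat (-2 * (d : ℚ) / ((x : ℚ) + 2 * (c : ℚ))) q) = Complex.I ^ k) :
    (8 ∣ p - 1 →
      (-(q : ZMod p)) ^ (p / 8) = (-1) ^ (x / 4) * ((d : ZMod p) / (c : ZMod p)) ^ k) ∧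
    (8 ∣ p - 5 →
      (-(q : ZMod p)) ^ (p / 8) =
        -(-1) ^ ((x ^ 2 - 1) / 8) * ((d : ZMod p) / (c : ZMod p)) ^ k *
          ((y : ZMod p) / (x : ZMod p))) := by
  have hq8 : q % 8 = 3 := hq
  have hc4 : c % 4 = 1 := hc
  have hy4 : y % 4 = 1 := hy
  have hda := Int.isCoprime_iff_gcd_eq_one.2 hgcd
  have hpo : Odd p := Nat.odd_iff.2 (by omega)
  have hqo : Odd q := Int.odd_iff.2 (by omega)
  have hyo : Odd y := Int.odd_iff.2 (by omega)
  have hco : Odd c := Int.odd_iff.2 (by omega)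
  have hx : Odd x := by
    by_contra h
    have h1 : Odd (x ^ 2 + q * y ^ 2) :=
      ((Int.not_odd_iff_even.1 h).pow_of_ne_zero two_ne_zero).add_odd (hqo.mul hyo.pow)
    rw [← hxy] at h1
    exact Int.not_odd_iff_even.2 ⟨2 * p, by ring⟩ h1
  have hd : Even d := by
    by_contra h
    have h1 : Even (c ^ 2 + d ^ 2) := hco.pow.add_odd (Int.not_even_iff_odd.1 h).pow
    rw [← hcd] at h1
    exact Int.not_odd_iff_even.2 h1 (by exact_mod_cast hpo)
  have hao : Odd (x + 2 * c) := hx.add_even (even_two_mul c)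
  obtain ⟨hyp, hxp, -, haqy⟩ := isCoprime_of_representation hqo hyo hao hpq hpo hcd hxy hda
  have ha0 : x + 2 * c ≠ 0 := by intro h; rw [h] at hao; exact absurd hao (by decide)
  have hrat : (-2 * (d : ℚ) / ((x : ℚ) + 2 * (c : ℚ))) =
      ((-2 * d : ℤ) : ℚ) / ((x + 2 * c : ℤ) : ℚ) := by push_cast; rfl
  rw [hrat, quarticJacobiSymbolRat_div hqo ha0 (IsCoprime.mul_right_iff.1 haqy).1] at hk
  have key := quarticJacobiSymbol_representation hp hq8 hpq hcd hxy hy4 hx hd hda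
  have hπn : Zsqrtd.norm (⟨c, d⟩ : GaussianInt) = p := by rw [norm_eq, hcd]
  have hπ := prime_of_norm_eq hπn
  have hπo := odd_norm_of_eq hπn hpo
  have hE := quarticExp_of_norm_eq hπn hpo
  obtain ⟨f, hfi, hf⟩ := exists_ringHom_zmod hπ hπn
  have hmap := map_quarticJacobiSymbol hπ hπo hf
  -- Reciprocity applies to whichever of ±x is 1 modulo 4; passing to -x costs (-1/π).
  have hxE : quarticJacobiSymbol ⟨c, d⟩ x =
      (if x % 4 = 1 then 1 else (-1) ^ quarticExp ⟨c, d⟩) * quarticJacobiSymbol x ⟨c, d⟩ := by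
    have hcop : IsCoprime (x : GaussianInt) ⟨c, d⟩ := isCoprime_intCast_of_norm (by rwa [hπn])
    split_ifs with h
    · rw [quarticJacobiSymbol_comm hπo hd h hcop, one_mul]
    · have h1 : -x ≡ 1 [ZMOD 4] := by
        rw [Int.odd_iff] at hx; change -x % 4 = 1; omega
      have := quarticJacobiSymbol_comm hπo hd h1 (by rw [Int.cast_neg]; exact hcop.neg_left)
      rw [Int.cast_neg, quarticJacobiSymbol_neg_right] at this
      rw [← this, ← quarticJacobiSymbol_neg_left hπo]
  have hu := map_eq_zpow_of_toComplex_eq f hk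
  rw [show f imUnit = (d : ZMod p) / c from hfi] at hu
  have key' := congrArg f key
  rw [hxE, map_mul, hu, hmap, map_neg, map_mul, map_mul, map_mul, hmap] at key'
  have hx0 : (x : ZMod p) ≠ 0 := by
    rw [Ne, ZMod.intCast_zmod_eq_zero_iff_dvd]
    exact fun h => (Nat.prime_iff_prime_int.1 Fact.out).not_isUnit (hxp.isUnit_of_dvd' h dvd_rfl)
  have hy0 : (y : ZMod p) ≠ 0 := by
    rw [Ne, ZMod.intCast_zmod_eq_zero_iff_dvd]
    exact fun h => (Nat.prime_iff_prime_int.1 Fact.out).not_isUnit (hyp.isUnit_of_dvd' h dvd_rfl)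
  have hqxy : -(q : ZMod p) = ((x : ZMod p) / y) ^ 2 := by
    have := congrArg (Int.cast : ℤ → ZMod p) hxy
    push_cast at this
    rw [ZMod.natCast_self, mul_zero] at this
    field_simp
    linear_combination this
  have hx8 : x % 8 = 1 ∨ x % 8 = 3 ∨ x % 8 = 5 ∨ x % 8 = 7 := by
    rw [Int.odd_iff] at hx; omega
  -- c² ≡ 1 modulo 8, so p ≡ 1 + d² modulo 8 with d even.
  have hd2 : Even (d / 2) ↔ (p : ℤ) % 8 = 1 := by
    obtain ⟨e, rfl⟩ := hd
    obtain ⟨t, ht⟩ : ∃ t, c = 4 * t + 1 := ⟨c / 4, by omega⟩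
    rw [show (e + e) / 2 = e by omega, hcd, ht]
    rcases Int.even_or_odd' e with ⟨s, rfl | rfl⟩
    · refine iff_of_true (even_two_mul s) ?_
      ring_nf; omega
    · refine iff_of_false (Int.not_even_two_mul_add_one s) ?_
      ring_nf; omega
  set E := quarticExp ⟨c, d⟩ with hEdef
  set w := ((d : ZMod p) / (c : ZMod p)) ^ k
  constructor
  · intro h8
    have hp8 : p % 8 = 1 := by have := (Fact.out : p.Prime).pos; omega
    have hEe : Even E := Nat.even_iff.2 (by omega)
    rw [if_pos (hd2.2 (by omega)), hEe.neg_one_pow, ite_self, map_one, one_mul, one_mul] at key'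
    rw [hqxy, ← pow_mul, show 2 * (p / 8) = E by omega, div_pow, div_eq_iff (pow_ne_zero _ hy0),
      mul_assoc, key']
    -- Since c ≡ 1 modulo 4, x + 2c ≡ x + 2 modulo 8, which is ±1 exactly for x ≡ 5, 7 modulo 8;
    -- these are the classes where the floor of x/4 is odd.
    rcases hx8 with h | h | h | h
    · rw [if_neg (by omega), Even.neg_one_zpow (Int.even_iff.2 (by omega))]
      simp
    · rw [if_neg (by omega), Even.neg_one_zpow (Int.even_iff.2 (by omega))]
      simp
    · rw [if_pos (by omega), Odd.neg_one_zpow (Int.odd_iff.2 (by omega))]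
      simp
    · rw [if_pos (by omega), Odd.neg_one_zpow (Int.odd_iff.2 (by omega))]
      simp
  · intro h8
    have hp8 : p % 8 = 5 := by
      rcases (show p % 8 = 1 ∨ p % 8 = 5 by omega) with h | h
      -- Truncated subtraction makes p - 5 zero for p = 1, which primality excludes.
      · exfalso
        have := (Fact.out : p.Prime).one_lt
        omega
      · exact h
    have hEo : Odd E := Nat.odd_iff.2 (by omega)
    have hsq : (x ^ 2 - 1) / 8 % 2 = if x % 8 = 1 ∨ x % 8 = 7 then 0 else 1 := by
      have hdiv := Int.mul_ediv_add_emod x 8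
      generalize x / 8 = t at hdiv
      rcases hx8 with h | h | h | h <;> rw [h] at hdiv ⊢ <;> subst hdiv <;> norm_num <;>
        ring_nf <;> omega
    rw [if_neg (by rw [hd2]; omega), hEo.neg_one_pow] at key'
    have hgoal : ((x : ZMod p) / y) ^ E = -(-1) ^ ((x ^ 2 - 1) / 8) * w := by
      rw [div_pow, div_eq_iff (pow_ne_zero _ hy0), mul_assoc, key']
      rcases hx8 with h | h | h | h
      · rw [if_neg (by omega), if_pos (by omega),
          Even.neg_one_zpow (Int.even_iff.2 (by rw [hsq, if_pos (by omega)]))]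
        simp
      · rw [if_neg (by omega), if_neg (by omega),
          Odd.neg_one_zpow (Int.odd_iff.2 (by rw [hsq, if_neg (by omega)]))]
        simp
      · rw [if_pos (by omega), if_pos (by omega),
          Odd.neg_one_zpow (Int.odd_iff.2 (by rw [hsq, if_neg (by omega)]))]
        simp
      · rw [if_pos (by omega), if_neg (by omega),
          Even.neg_one_zpow (Int.even_iff.2 (by rw [hsq, if_pos (by omega)]))]
        simp
    -- Here (p - 1)/4 = 2[p/8] + 1, and the odd factor x/y is what y/x in the statement cancels.
    rw [← hgoal, hqxy, ← pow_mul, show E = 2 * (p / 8) + 1 by omega, pow_succ, mul_assoc]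
    rw [show (x : ZMod p) / y * (y / x) = 1 by field_simp, mul_one]
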